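/- Let $n\ge 2$ and let $U\subset\mathbb{R}^n$ be open, convex and non-empty. A Randers metric on $U$ is a Finsler function $F=a+b$, where $a(x,y)=\sqrt{g_{ij}(x)y^iy^j}$ for a smooth Riemannian metric $g$ on $U$ and $b(x,y)=b_i(x)y^i$ for a smooth $1$-form on $U$; here a Finsler function is a continuous function $F(x,y)$ on $U\times\mathbb{R}^n$ that is smooth and positive for $y\ne0$, positively $1$-homogeneous in $y$, and has $\tfrac12\,\partial^2F^2/\partial y^i\partial y^j$ of rank $n$ for $y\neq 0$. It is projectively flat with projective factor $P$ if its geodesic spray is $y^i\frac{\partial}{\partial x^i}-2P\,y^i\frac{\partial}{\partial y^i}$, with $P$ smooth and positively $1$-homogeneous in $y$ for $y\ne0$. It has constant flag curvature $\kappa$ if the Jacobi endomorphism of its geodesic spray is $R^i_j=\kappa\big(F^2\delta^i_j-F\frac{\partial F}{\partial y^j}y^i\big)$ for $y\neq 0$. For a real $c\ne0$ put, on the ball $B_c=\{x\in\mathbb{R}^n: 4c^2|x|^2<1\}$, $$a_c=\frac{\sqrt{|y|^2-4c^2(|x|^2|y|^2-\langle x,y\rangle^2)}}{1-4c^2|x|^2},\qquad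 b_c=\frac{2c\langle x,y\rangle}{1-4c^2|x|^2}.$$ 1. For every $c\neq0$, $F_c=a_c+b_c$ is a Randers metric on $B_c$; it is projectively flat with projective factor $P=cF_c$ and has constant flag curvature $-c^2$. 2. Let $c,\kappa,\mu\in\mathbb{R}$ with $1+\mu|x|^2>0$ on $U$, and let $a$ be the projectively flat Riemannian model $a=\frac{\sqrt{|y|^2+\mu(|x|^2|y|^2-\langle x,y\rangle^2)}}{1+\mu|x|^2}$ on $U$. Then $F=a+b$ is a projectively flat Randers metric on $U$ of negative constant flag curvature $\kappa$ with projective factor $P=cF$ if and only if $c\ne0$, $\kappa=-c^2$, $\mu=-4c^2$, $U\subseteq B_c$, $a=a_c$ and $b=b_c$ on $U$. 3. In general, let $a,b$ be functions on $U\times\mathbb{R}^n$ and $c,\kappa\in\mathbb{R}$. Then $F=a+b$ is a Randers metric on $U$ with Riemannian part $a$ and $1$-form part $b$ that is projectively flat, of negative constant flag curvature $\kappa$, with projective factor $P=cF$, if and only if $c\ne0$, $\kappa=-c^2$ and $F$ is a member of the family up to an affine change of coordinates: there is an affine automorphism $\varphi$ of $\mathbb{R}^n$ with linear part $L$ such that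 $\varphi(U)\subseteq B_c$ and $a(x,y)=a_c(\varphi(x),Ly)$, $b(x,y)=b_c(\varphi(x),Ly)$ for all $x\in U$, $y\in\mathbb{R}^n$. -/

import Mathlib

open scoped ContDiff

noncomputable section

namespace FinslerGeom

section General

variable {E : Type*} [NormedAddCommGroup E] [NormedSpace ℝ E]

/-- The slit tangent bundle `T₀U = {(x, y) : x ∈ U, y ≠ 0}` of a domain `U` in a vector space. -/
def slit (U : Set E) : Set (E × E) := {z | z.1 ∈ U ∧ z.2 ≠ 0}

/-- The components `g_{(x,y)}(v, w) = (1/2) ∂²F²/∂y² (v, w)` of the metric tensor of `F`. -/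
def metricTensor (F : E × E → ℝ) (z : E × E) (v w : E) : ℝ :=
  (1 / 2) * fderiv ℝ (fun p => fderiv ℝ (fun q => F q ^ 2) p (0, w)) z (0, v)

/-- Finsler functions `F(x, y)` on a domain `U`. -/
structure IsFinsler (U : Set E) (F : E × E → ℝ) : Prop where
  continuousOn : ContinuousOn F (U ×ˢ Set.univ)
  smooth : ContDiffOn ℝ ∞ F (slit U)
  pos : ∀ z ∈ slit U, 0 < F z
  homogeneous : ∀ x ∈ U, ∀ y : E, ∀ t : ℝ, 0 < t → F (x, t • y) = t * F (x, y)
  nondegenerate : ∀ z ∈ slit U, ∀ v : E, (∀ w : E, metricTensor F z v w = 0) → v = 0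

/-- The action `S f` on functions of the semispray `S = yⁱ ∂/∂xⁱ - 2 Gⁱ(x, y) ∂/∂yⁱ`
with coefficients `G`. -/
def sprayDeriv (G : E × E → E) (f : E × E → ℝ) (z : E × E) : ℝ :=
  fderiv ℝ f z (z.2, -((2 : ℝ) • G z))

/-- The Euler-Lagrange 1-form `δ_S L = (S(∂L/∂yⁱ) - ∂L/∂xⁱ) dxⁱ`, evaluated at the vector `v`. -/
def eulerLagrange (G : E × E → E) (L : E × E → ℝ) (z : E × E) (v : E) : ℝ :=
  sprayDeriv G (fun p => fderiv ℝ L p (0, v)) z - fderiv ℝ L z (v, 0)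

/-- `G` is the system of coefficients of a spray on `U`: smooth on the slit tangent bundle and
positively homogeneous of degree two in `y`. -/
structure IsSpray (U : Set E) (G : E × E → E) : Prop where
  smooth : ContDiffOn ℝ ∞ G (slit U)
  homogeneous : ∀ x ∈ U, ∀ y : E, y ≠ 0 → ∀ t : ℝ, 0 < t → G (x, t • y) = t ^ 2 • G (x, y)

/-- The geodesic spray of `F`: the spray `S` with `δ_S F² = 0`. It is unique on the slit tangent
bundle when `F` is a Finsler function. -/
structure IsGeodesicSpray (U : Set E) (F : E × E → ℝ) (G : E × E → E) : Prop where
  spray : IsSpray U G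
  euler_lagrange : ∀ z ∈ slit U, ∀ v : E, eulerLagrange G (fun p => F p ^ 2) z v = 0

/-- The nonlinear connection `N_jⁱ = ∂Gⁱ/∂yʲ`, as a linear map applied to `v`. -/
def connection (G : E × E → E) (z : E × E) (v : E) : E := fderiv ℝ G z (0, v)

/-- The Jacobi endomorphism
`R_jⁱ = 2 δGⁱ/δxʲ - S(N_jⁱ) + N_kⁱ N_jᵏ`, where `δ/δxʲ = ∂/∂xʲ - N_jᵏ ∂/∂yᵏ`,
as a linear map applied to `v`. -/
def jacobiEndo (G : E × E → E) (z : E × E) (v : E) : E :=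
  (2 : ℝ) • fderiv ℝ G z (v, -(connection G z v))
    - fderiv ℝ (fun p => connection G p v) z (z.2, -((2 : ℝ) • G z))
    + connection G z (connection G z v)

/-- `F` has constant flag curvature `κ`: the Jacobi endomorphism of its geodesic spray is
`Φ = κ F² J - κ F d_J F ⊗ 𝒞`. -/
def HasConstantFlagCurvature (U : Set E) (F : E × E → ℝ) (κ : ℝ) : Prop :=
  ∃ G : E × E → E, IsGeodesicSpray U F G ∧ ∀ z ∈ slit U, ∀ v : E,
    jacobiEndo G z v = κ • (F z ^ 2 • v - (F z * fderiv ℝ F z (0, v)) • z.2)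

/-- `F` is projectively flat on `U` with projective factor `P`: its geodesic spray is
`S₀ - 2 P 𝒞`, where `S₀ = yⁱ ∂/∂xⁱ` is the flat spray, `𝒞 = yⁱ ∂/∂yⁱ`, and `P` is smooth and
positively homogeneous of degree one on the slit tangent bundle. -/
structure IsProjectivelyFlatWith (U : Set E) (F P : E × E → ℝ) : Prop where
  smooth : ContDiffOn ℝ ∞ P (slit U)
  homogeneous : ∀ x ∈ U, ∀ y : E, y ≠ 0 → ∀ t : ℝ, 0 < t → P (x, t • y) = t * P (x, y)
  geodesicSpray : IsGeodesicSpray U F (fun z => P z • z.2)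

/-- `F` is projectively flat and its projective factor `P` is `c F`. -/
def IsProjectivelyFlatProportional (U : Set E) (F : E × E → ℝ) (c : ℝ) : Prop :=
  ∃ P : E × E → ℝ, IsProjectivelyFlatWith U F P ∧ ∀ z ∈ slit U, P z = c * F z

/-- `a(x, y) = √(g_{ij}(x) yⁱ yʲ)` for a (smooth, positive definite) Riemannian metric `g`. -/
def IsRiemannian (U : Set E) (a : E × E → ℝ) : Prop :=
  ∃ g : E → E →L[ℝ] E →L[ℝ] ℝ, ContDiffOn ℝ ∞ g U ∧
    (∀ x ∈ U, ∀ v w : E, g x v w = g x w v) ∧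
    (∀ x ∈ U, ∀ v : E, v ≠ 0 → 0 < g x v v) ∧
    ∀ x ∈ U, ∀ y : E, a (x, y) = Real.sqrt (g x y y)

/-- `b(x, y) = b_i(x) yⁱ` for a smooth 1-form. -/
def IsOneForm (U : Set E) (b : E × E → ℝ) : Prop :=
  ∃ β : E → E →L[ℝ] ℝ, ContDiffOn ℝ ∞ β U ∧ ∀ x ∈ U, ∀ y : E, b (x, y) = β x y

/-- `F = a + b` is a Randers metric on `U`. -/
structure IsRanders (U : Set E) (a b : E × E → ℝ) : Prop where
  riemannian : IsRiemannian U a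
  oneForm : IsOneForm U b
  finsler : IsFinsler U (a + b)

/-- `F = a + b` is a projectively flat Randers metric on `U`, of negative constant flag
curvature `κ`, whose projective factor is `c F`. -/
structure IsProportionalRanders (U : Set E) (a b : E × E → ℝ) (c κ : ℝ) : Prop where
  randers : IsRanders U a b
  flat : IsProjectivelyFlatProportional U (a + b) c
  curvature : HasConstantFlagCurvature U (a + b) κ
  negative : κ < 0

end General

section Models

variable {n : ℕ}

/-- The model
`√(|y|² + μ (|x|² |y|² - ⟨x, y⟩²)) / (1 + μ |x|²)` of projectively flat Riemannian metrics. -/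
def kleinMetric (μ : ℝ) (z : EuclideanSpace ℝ (Fin n) × EuclideanSpace ℝ (Fin n)) : ℝ :=
  Real.sqrt (‖z.2‖ ^ 2 + μ * (‖z.1‖ ^ 2 * ‖z.2‖ ^ 2 - inner ℝ z.1 z.2 ^ 2)) / (1 + μ * ‖z.1‖ ^ 2)

def modelA (c : ℝ) (z : EuclideanSpace ℝ (Fin n) × EuclideanSpace ℝ (Fin n)) : ℝ :=
  Real.sqrt (‖z.2‖ ^ 2 - 4 * c ^ 2 * (‖z.1‖ ^ 2 * ‖z.2‖ ^ 2 - inner ℝ z.1 z.2 ^ 2)) /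
    (1 - 4 * c ^ 2 * ‖z.1‖ ^ 2)

def modelB (c : ℝ) (z : EuclideanSpace ℝ (Fin n) × EuclideanSpace ℝ (Fin n)) : ℝ :=
  2 * c * inner ℝ z.1 z.2 / (1 - 4 * c ^ 2 * ‖z.1‖ ^ 2)

/-- The ball `4 c² |x|² < 1` on which `modelA c` and `modelB c` live. -/
def modelBall (n : ℕ) (c : ℝ) : Set (EuclideanSpace ℝ (Fin n)) :=
  {x | 4 * c ^ 2 * ‖x‖ ^ 2 < 1}

end Models

end FinslerGeom

end

/-! The whole condition on `F` collapses to a first order equation. Let `S` be the spray with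
coefficients `P y`. The Euler-Lagrange equation and homogeneity give `S(F²) = 0`; differentiating
this in `y` and inserting `P = c F` gives `∂F/∂xʲ = 2 c F ∂F/∂yʲ`
(`IsProjectivelyFlatProportional.fderiv_horizontal`). Conversely, this equation makes `c F y` the
geodesic spray and forces flag curvature `-c²` (`jacobiEndo_eq`). Hence `κ = -c²` is automatic, and
negative curvature means `c ≠ 0`.

For `F = √g + β`, the parts of the equation odd and even in `y` separate into a system for `Dβ` and
`Dg` (`isProportionalRanders_iff`). The models solve it by direct differentiation.

For the converse, the system makes `β` closed, so `β = df` on the convex set `U`. With `ψ = exp(-4 c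
f)`, the form `Q = ψ (g - β ⊗ β)` does not depend on the point, and `ψ` is a quadratic polynomial `M
- 4 c² Q(x - x₁, x - x₁)`. An affine map sending `x₁` to the origin and `M⁻¹ Q` to the Euclidean
inner product turns `ψ` into `M (1 - 4 c² |x|²)`, hence `g` and `β` into the model
(`exists_affineEquiv_of_system`). When `a` is already in the normal form with parameter `μ`, the
system on the diagonal `u = y` determines `β` and `μ` without a change of coordinates
(`form_eq_of_kleinMetric`). -/

noncomputable section

namespace FinslerGeom

/-! ### Projectively flat sprays and the equation `∂F/∂x = 2 c F ∂F/∂y` -/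

section General

variable {E : Type*} [NormedAddCommGroup E] [NormedSpace ℝ E]

omit [NormedSpace ℝ E] in
theorem isOpen_slit {U : Set E} (hU : IsOpen U) : IsOpen (slit U) :=
  (hU.preimage continuous_fst).inter (isOpen_ne.preimage continuous_snd)

theorem differentiableAt_of_mem_slit {F' : Type*} [NormedAddCommGroup F']
    [NormedSpace ℝ F'] {U : Set E} (hU : IsOpen U) {f : E × E → F'}
    (hf : ContDiffOn ℝ ∞ f (slit U)) {z : E × E} (hz : z ∈ slit U) : DifferentiableAt ℝ f z :=
  (hf.contDiffAt ((isOpen_slit hU).mem_nhds hz)).differentiableAt (by simp)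

theorem differentiableAt_fderiv_of_mem_slit {F' : Type*} [NormedAddCommGroup F']
    [NormedSpace ℝ F'] {U : Set E} (hU : IsOpen U) {f : E × E → F'}
    (hf : ContDiffOn ℝ ∞ f (slit U)) {z : E × E} (hz : z ∈ slit U) :
    DifferentiableAt ℝ (fderiv ℝ f) z :=
  ((hf.contDiffAt ((isOpen_slit hU).mem_nhds hz)).fderiv_right (m := 1)
    (by norm_cast)).differentiableAt
    (by simp)

/-- Euler's relation for positively `1`-homogeneous functions. -/
theorem fderiv_vertical_self {U : Set E} {F : E × E → ℝ} {z : E × E} (hz : z ∈ slit U)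
    (hF : DifferentiableAt ℝ F z)
    (hom : ∀ x ∈ U, ∀ y : E, y ≠ 0 → ∀ t : ℝ, 0 < t → F (x, t • y) = t * F (x, y)) :
    fderiv ℝ F z (0, z.2) = F z := by
  have h1 : HasDerivAt (fun t : ℝ => ((z.1, t • z.2) : E × E)) (0, z.2) 1 := by
    have h := ((hasDerivAt_id (1 : ℝ)).smul_const z.2)
    simpa using (hasDerivAt_const (1 : ℝ) z.1).prodMk h
  have h2 : HasDerivAt (fun t : ℝ => F (z.1, t • z.2)) (fderiv ℝ F z (0, z.2)) 1 := by
    have h3 : HasFDerivAt F (fderiv ℝ F z) ((fun t : ℝ => ((z.1, t • z.2) : E × E)) 1) := by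
      simpa using hF.hasFDerivAt
    exact h3.comp_hasDerivAt 1 h1
  have h4 : HasDerivAt (fun t : ℝ => F (z.1, t • z.2)) (F z) 1 := by
    have h5 : HasDerivAt (fun t : ℝ => t * F z) (F z) 1 := by
      simpa using (hasDerivAt_id (1 : ℝ)).mul_const (F z)
    refine h5.congr_of_eventuallyEq ?_
    filter_upwards [lt_mem_nhds (zero_lt_one' ℝ)] with t ht
    exact hom z.1 hz.1 z.2 hz.2 t ht
  exact h2.unique h4

theorem fderiv_sq {F : E × E → ℝ} {z : E × E} (hF : DifferentiableAt ℝ F z) (w : E × E) :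
    fderiv ℝ (fun p => F p ^ 2) z w = 2 * F z * fderiv ℝ F z w := by
  have h := (hF.hasFDerivAt.pow 2).fderiv
  rw [h]
  simp

/-- Vertical differentiation of an identity `S L = 0`, where `S` is the spray with coefficients
`P y`. -/
theorem sprayDeriv_fderiv_vertical {U : Set E} (hU : IsOpen U) {L P : E × E → ℝ}
    (hL : ContDiffOn ℝ ∞ L (slit U)) (hP : ContDiffOn ℝ ∞ P (slit U))
    (h0 : ∀ z ∈ slit U, fderiv ℝ L z (z.2, -((2 : ℝ) • (P z • z.2))) = 0)
    {z : E × E} (hz : z ∈ slit U) (v : E) :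
    sprayDeriv (fun p => P p • p.2) (fun p => fderiv ℝ L p (0, v)) z
      = - fderiv ℝ L z (v, 0) + 2 * fderiv ℝ P z (0, v) * fderiv ℝ L z (0, z.2)
        + 2 * P z * fderiv ℝ L z (0, v) := by
  have dP := (differentiableAt_of_mem_slit hU hP hz).hasFDerivAt
  have dDL := (differentiableAt_fderiv_of_mem_slit hU hL hz).hasFDerivAt
  have dsnd : HasFDerivAt (fun p : E × E => p.2) (ContinuousLinearMap.snd ℝ E E) z :=
    hasFDerivAt_snd
  have dX := dsnd.prodMk (((dP.smul dsnd).const_smul (2 : ℝ)).neg)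
  have h1 : HasFDerivAt (fun p => fderiv ℝ L p (p.2, -((2 : ℝ) • (P p • p.2)))) _ z :=
    dDL.clm_apply dX
  have h2 := h1.congr_of_eventuallyEq (f₁ := fun _ => (0 : ℝ)) (by
    filter_upwards [(isOpen_slit hU).mem_nhds hz] with p hp
    exact (h0 p hp).symm)
  have h3 := DFunLike.congr_fun (h2.unique (hasFDerivAt_const 0 z)) (0, v)
  -- Symmetry of the second derivative exchanges the order of `S` and the vertical direction, so the
  -- differentiated identity yields `S(∂L/∂y)`.
  have hs : fderiv ℝ (fderiv ℝ L) z (0, v) (z.2, -((2 : ℝ) • (P z • z.2)))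
      = fderiv ℝ (fderiv ℝ L) z (z.2, -((2 : ℝ) • (P z • z.2))) (0, v) :=
    ((hL.contDiffAt ((isOpen_slit hU).mem_nhds hz)).isSymmSndFDerivAt
      (by rw [minSmoothness_of_isRCLikeNormedField]; norm_cast)) _ _
  have h4 : fderiv ℝ (fun p => fderiv ℝ L p (0, v)) z
      = (fderiv ℝ (fderiv ℝ L) z).flip (0, v) := by
    have := (dDL.clm_apply (hasFDerivAt_const ((0, v) : E × E) z)).fderiv
    rw [this]; ext <;> simp
  have h5 : (v, -((2 : ℝ) • (P z • v + fderiv ℝ P z (0, v) • z.2))) = ((v, 0) : E × E)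
      - (2 * fderiv ℝ P z (0, v)) • ((0, z.2) : E × E) - (2 * P z) • ((0, v) : E × E) := by
    ext <;> simp [smul_smul, mul_comm]
    module
  simp only [add_apply, ContinuousLinearMap.comp_apply,
    ContinuousLinearMap.flip_apply, ContinuousLinearMap.prod_apply, ContinuousLinearMap.coe_snd',
    neg_apply, smul_apply,
    ContinuousLinearMap.smulRight_apply, zero_apply] at h3
  rw [hs, h5] at h3
  simp only [map_sub, map_smul, smul_eq_mul] at h3
  rw [sprayDeriv, h4]
  simp only [ContinuousLinearMap.flip_apply]
  linarith

theorem horizontal_split (f : E × E →L[ℝ] ℝ) (u v : E) (r : ℝ) :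
    f (u, -((2 : ℝ) • (r • v))) = f (u, 0) - 2 * r * f (0, v) := by
  have h : ((u, -((2 : ℝ) • (r • v))) : E × E) = (u, 0) - (2 * r) • (0, v) := by
    ext <;> simp [smul_smul]
  rw [h, map_sub, map_smul, smul_eq_mul]

/-- A function with geodesic spray `P y` is constant along that spray. -/
theorem IsGeodesicSpray.fderiv_sq_apply {U : Set E} (hU : IsOpen U) {F P : E × E → ℝ}
    (hF : ContDiffOn ℝ ∞ F (slit U))
    (hom : ∀ x ∈ U, ∀ y : E, y ≠ 0 → ∀ t : ℝ, 0 < t → F (x, t • y) = t * F (x, y))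
    (hG : IsGeodesicSpray U F (fun z => P z • z.2)) {z : E × E} (hz : z ∈ slit U) :
    fderiv ℝ (fun p => F p ^ 2) z (z.2, -((2 : ℝ) • (P z • z.2))) = 0 := by
  set L : E × E → ℝ := fun p => F p ^ 2 with hLdef
  have hL : ContDiffOn ℝ ∞ L (slit U) := hF.pow 2
  have euler : ∀ p ∈ slit U, fderiv ℝ L p (0, p.2) = 2 * L p := fun p hp => by
    have hd := differentiableAt_of_mem_slit hU hF hp
    rw [hLdef, fderiv_sq hd, fderiv_vertical_self hp hd hom]; ring
  have dL := (differentiableAt_of_mem_slit hU hL hz).hasFDerivAt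
  have dDL := (differentiableAt_fderiv_of_mem_slit hU hL hz).hasFDerivAt
  have dsnd : HasFDerivAt (fun p : E × E => p.2) (ContinuousLinearMap.snd ℝ E E) z :=
    hasFDerivAt_snd
  have h1 := dDL.clm_apply ((hasFDerivAt_const (0 : E) z).prodMk dsnd)
  have h2 := h1.congr_of_eventuallyEq (f₁ := fun p => 2 * L p) (by
    filter_upwards [(isOpen_slit hU).mem_nhds hz] with p hp
    exact (euler p hp).symm)
  have h3 := DFunLike.congr_fun (h2.unique (dL.const_mul 2)) (z.2, -((2 : ℝ) • (P z • z.2)))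
  have h4 : fderiv ℝ (fun p => fderiv ℝ L p (0, z.2)) z
      = (fderiv ℝ (fderiv ℝ L) z).flip (0, z.2) := by
    have := (dDL.clm_apply (hasFDerivAt_const ((0, z.2) : E × E) z)).fderiv
    rw [this]; ext <;> simp
  -- The Euler-Lagrange equation in the direction `v = y`. Against the derivative along `S` of
  -- Euler's relation `∂L/∂y (y) = 2 L`, it leaves `S L = 2 S L`.
  have h5 := hG.euler_lagrange z hz z.2
  simp only [eulerLagrange, sprayDeriv] at h5
  rw [h4] at h5
  simp only [add_apply, ContinuousLinearMap.comp_apply,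
    ContinuousLinearMap.flip_apply, ContinuousLinearMap.prod_apply, ContinuousLinearMap.coe_snd',
    smul_apply, zero_apply, smul_eq_mul] at h3 h5
  have h6 := horizontal_split (fderiv ℝ L z) 0 z.2 (P z)
  rw [Prod.mk_zero_zero, map_zero] at h6
  rw [h6] at h3
  have h7 := horizontal_split (fderiv ℝ L z) z.2 z.2 (P z)
  linarith

/-- If the projective factor of a projectively flat `F` is `c F`, then `F` solves
`∂F/∂xʲ = 2 c F ∂F/∂yʲ`. -/
theorem IsProjectivelyFlatProportional.fderiv_horizontal {U : Set E} (hU : IsOpen U)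
    {F : E × E → ℝ} {c : ℝ} (hF : ContDiffOn ℝ ∞ F (slit U)) (pos : ∀ z ∈ slit U, 0 < F z)
    (hom : ∀ x ∈ U, ∀ y : E, y ≠ 0 → ∀ t : ℝ, 0 < t → F (x, t • y) = t * F (x, y))
    (h : IsProjectivelyFlatProportional U F c) {z : E × E} (hz : z ∈ slit U) (v : E) :
    fderiv ℝ F z (v, 0) = 2 * c * F z * fderiv ℝ F z (0, v) := by
  obtain ⟨P, hP, hPF⟩ := h
  have dF := differentiableAt_of_mem_slit hU hF hz
  have h1 := sprayDeriv_fderiv_vertical hU (hF.pow 2) hP.smooth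
    (fun z hz => hP.geodesicSpray.fderiv_sq_apply hU hF hom hz) hz v
  have h2 := hP.geodesicSpray.euler_lagrange z hz v
  rw [eulerLagrange, h1] at h2
  have h3 : fderiv ℝ P z (0, v) = c * fderiv ℝ F z (0, v) := by
    have : P =ᶠ[nhds z] fun p => c * F p := by
      filter_upwards [(isOpen_slit hU).mem_nhds hz] with p hp using hPF p hp
    rw [this.fderiv_eq, (dF.hasFDerivAt.const_mul c).fderiv]; simp
  rw [fderiv_sq dF, fderiv_sq dF, fderiv_sq dF, h3, hPF z hz, fderiv_vertical_self hz dF hom] at h2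
  have h4 := pos z hz
  have h5 : F z * (fderiv ℝ F z (v, 0) - 2 * c * F z * fderiv ℝ F z (0, v)) = 0 := by
    linear_combination (-1 / 4) * h2
  rcases mul_eq_zero.1 h5 with h6 | h6
  · exact absurd h6 h4.ne'
  · linarith

/-! ### From the equation back to the spray and its curvature -/

section Burgers

variable {U : Set E} (hU : IsOpen U) {F : E × E → ℝ} {c : ℝ} (hF : ContDiffOn ℝ ∞ F (slit U))
  (hom : ∀ x ∈ U, ∀ y : E, y ≠ 0 → ∀ t : ℝ, 0 < t → F (x, t • y) = t * F (x, y))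
  (hB : ∀ z ∈ slit U, ∀ v : E, fderiv ℝ F z (v, 0) = 2 * c * F z * fderiv ℝ F z (0, v))

include hU hF

theorem connection_eq {z : E × E} (hz : z ∈ slit U) (v : E) :
    connection (fun z => (c * F z) • z.2) z v
      = (c * fderiv ℝ F z (0, v)) • z.2 + (c * F z) • v := by
  have dF := (differentiableAt_of_mem_slit hU hF hz).hasFDerivAt
  have dsnd : HasFDerivAt (fun p : E × E => p.2) (ContinuousLinearMap.snd ℝ E E) z :=
    hasFDerivAt_snd
  have h : HasFDerivAt (fun z => (c * F z) • z.2) _ z := (dF.const_mul c).smul dsnd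
  rw [connection, h.fderiv]
  simp [add_comm]

include hom hB

theorem fderiv_spray_eq_zero {z : E × E} (hz : z ∈ slit U) :
    fderiv ℝ F z (z.2, -((2 : ℝ) • ((c * F z) • z.2))) = 0 := by
  rw [horizontal_split, hB z hz,
    fderiv_vertical_self hz (differentiableAt_of_mem_slit hU hF hz) hom]
  ring

theorem fderiv_spray_fderiv_vertical {z : E × E} (hz : z ∈ slit U) (v : E) :
    fderiv ℝ (fun p => fderiv ℝ F p (0, v)) z (z.2, -((2 : ℝ) • ((c * F z) • z.2)))
      = 2 * c * F z * fderiv ℝ F z (0, v) := by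
  have dF := differentiableAt_of_mem_slit hU hF hz
  have h := sprayDeriv_fderiv_vertical hU hF (contDiffOn_const.mul hF : ContDiffOn ℝ ∞
    (fun p => c * F p) (slit U)) (fun z hz => fderiv_spray_eq_zero hU hF hom hB hz) hz v
  rw [sprayDeriv] at h
  rw [h, (dF.hasFDerivAt.const_mul c).fderiv, hB z hz, fderiv_vertical_self hz dF hom]
  simp only [smul_apply, smul_eq_mul]
  ring

/-- Since `S F = 0` and `S(∂F/∂y) = 2 c F ∂F/∂y = ∂F/∂x`, the two terms of the Euler-Lagrange form
of `F²` are both `2 F ∂F/∂x`. -/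
theorem isGeodesicSpray_of_fderiv_horizontal :
    IsGeodesicSpray U F (fun z => (c * F z) • z.2) := by
  refine ⟨⟨(contDiffOn_const.mul hF).smul contDiff_snd.contDiffOn, ?_⟩, ?_⟩
  · intro x hx y hy t ht
    simp only [hom x hx y hy t ht, smul_smul]
    congr 1; ring
  · intro z hz v
    have dF := differentiableAt_of_mem_slit hU hF hz
    have dDF := differentiableAt_fderiv_of_mem_slit hU hF hz
    have h1 : (fun p => fderiv ℝ (fun q => F q ^ 2) p (0, v)) =ᶠ[nhds z]
        fun p => 2 * F p * fderiv ℝ F p (0, v) := by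
      filter_upwards [(isOpen_slit hU).mem_nhds hz] with p hp
      exact fderiv_sq (differentiableAt_of_mem_slit hU hF hp) _
    have h2 : DifferentiableAt ℝ (fun p => fderiv ℝ F p (0, v)) z :=
      dDF.clm_apply (differentiableAt_const _)
    have h3 : HasFDerivAt (fun p => 2 * F p * fderiv ℝ F p (0, v)) _ z :=
      (dF.hasFDerivAt.const_mul 2).mul h2.hasFDerivAt
    rw [eulerLagrange, sprayDeriv, h1.fderiv_eq, h3.fderiv, fderiv_sq dF]
    simp only [add_apply, smul_apply, smul_eq_mul]
    rw [fderiv_spray_eq_zero hU hF hom hB hz, fderiv_spray_fderiv_vertical hU hF hom hB hz, hB z hz]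
    ring

/-- With `N v = c F_v y + c F v`, where `F_v` is the vertical derivative of `F` along `v`, the term
`S(N v)` vanishes and the horizontal derivative of `F` is zero. What is left is `N (N v) - 2 c F N
v`. -/
theorem jacobiEndo_eq {z : E × E} (hz : z ∈ slit U) (v : E) :
    jacobiEndo (fun z => (c * F z) • z.2) z v
      = (-c ^ 2) • (F z ^ 2 • v - (F z * fderiv ℝ F z (0, v)) • z.2) := by
  have dF := (differentiableAt_of_mem_slit hU hF hz).hasFDerivAt
  have dDF := differentiableAt_fderiv_of_mem_slit hU hF hz
  have dsnd : HasFDerivAt (fun p : E × E => p.2) (ContinuousLinearMap.snd ℝ E E) z :=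
    hasFDerivAt_snd
  have h1 : (fun p => connection (fun z => (c * F z) • z.2) p v) =ᶠ[nhds z]
      fun p => (c * fderiv ℝ F p (0, v)) • p.2 + (c * F p) • v := by
    filter_upwards [(isOpen_slit hU).mem_nhds hz] with p hp
    exact connection_eq hU hF hp v
  have h2 : DifferentiableAt ℝ (fun p => fderiv ℝ F p (0, v)) z :=
    dDF.clm_apply (differentiableAt_const _)
  have h3 : ∀ w : E, ((v, -w) : E × E) = (v, 0) - (0, w) := fun w => by simp
  have e := fderiv_vertical_self hz dF.differentiableAt hom
  have h5 : HasFDerivAt (fun z => (c * F z) • z.2) _ z := (dF.const_mul c).smul dsnd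
  have h6 : HasFDerivAt (fun p => (c * fderiv ℝ F p (0, v)) • p.2 + (c * F p) • v) _ z :=
    ((h2.hasFDerivAt.const_mul c).smul dsnd).add ((dF.const_mul c).smul_const v)
  rw [jacobiEndo, h1.fderiv_eq, h6.fderiv, h5.fderiv, h3]
  simp only [connection_eq hU hF hz, add_apply,
    smul_apply, ContinuousLinearMap.smulRight_apply, smul_eq_mul, map_sub,
    ContinuousLinearMap.coe_snd', fderiv_spray_eq_zero hU hF hom hB hz,
    fderiv_spray_fderiv_vertical hU hF hom hB hz, hB z hz]
  -- The right side is also `∂F/∂x (v)`: the horizontal derivative `δF/δx` vanishes.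
  have h4 : fderiv ℝ F z (0, (c * fderiv ℝ F z (0, v)) • z.2 + (c * F z) • v)
      = 2 * c * F z * fderiv ℝ F z (0, v) := by
    have : ((0, (c * fderiv ℝ F z (0, v)) • z.2 + (c * F z) • v) : E × E)
      = (c * fderiv ℝ F z (0, v)) • (0, z.2) + (c * F z) • (0, v) := by ext <;> simp
    rw [this, map_add, map_smul, map_smul, e]
    simp only [smul_eq_mul]; ring
  rw [h4]
  module

end Burgers

/-- The geodesic spray of a Finsler function is unique on the slit tangent bundle. -/
theorem IsGeodesicSpray.eqOn {U : Set E} {F : E × E → ℝ} (hF : IsFinsler U F)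
    {G₁ G₂ : E × E → E} (h₁ : IsGeodesicSpray U F G₁) (h₂ : IsGeodesicSpray U F G₂) :
    Set.EqOn G₁ G₂ (slit U) := by
  intro z hz
  have key : ∀ v : E, fderiv ℝ (fun p => fderiv ℝ (fun q => F q ^ 2) p (0, v)) z
      (0, G₁ z - G₂ z) = 0 := by
    intro v
    have e₁ := h₁.euler_lagrange z hz v
    have e₂ := h₂.euler_lagrange z hz v
    simp only [eulerLagrange, sprayDeriv] at e₁ e₂
    -- Two semisprays differ by a vertical vector, so subtracting their Euler-Lagrange equations
    -- leaves only the vertical Hessian of `F²`.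
    have : ((0, G₁ z - G₂ z) : E × E) = (-(1 / 2 : ℝ)) •
        ((z.2, -((2 : ℝ) • G₁ z)) - (z.2, -((2 : ℝ) • G₂ z))) := by
      ext
      · simp
      · simp only [Prod.mk_sub_mk, Prod.smul_mk]; module
    rw [this, map_smul, map_sub, smul_eq_mul]
    linear_combination (-(1 / 2 : ℝ)) * (e₁ - e₂)
  refine sub_eq_zero.1 (hF.nondegenerate z hz _ fun w => ?_)
  rw [metricTensor, key, mul_zero]

theorem jacobiEndo_congr {U : Set E} (hU : IsOpen U) {G₁ G₂ : E × E → E}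
    (h : Set.EqOn G₁ G₂ (slit U)) {z : E × E} (hz : z ∈ slit U) (v : E) :
    jacobiEndo G₁ z v = jacobiEndo G₂ z v := by
  have hev : ∀ p ∈ slit U, G₁ =ᶠ[nhds p] G₂ := fun p hp =>
    Filter.eventuallyEq_of_mem ((isOpen_slit hU).mem_nhds hp) h
  have hc : ∀ p ∈ slit U, ∀ w, connection G₁ p w = connection G₂ p w := fun p hp w => by
    rw [connection, connection, (hev p hp).fderiv_eq]
  have hc' : (fun p => connection G₁ p v) =ᶠ[nhds z] fun p => connection G₂ p v :=
    Filter.eventuallyEq_of_mem ((isOpen_slit hU).mem_nhds hz) fun p hp => hc p hp v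
  rw [jacobiEndo, jacobiEndo, (hev z hz).fderiv_eq, hc'.fderiv_eq, h hz, hc z hz, hc z hz]

/-- By uniqueness of the geodesic spray both curvature formulas hold at once. A second direction `v`
independent of `y` is needed, because both sides vanish for `v` parallel to `y`. -/
theorem flagCurvature_eq {U : Set E} (hU : IsOpen U) (hne : U.Nonempty)
    (hE : ∃ y v : E, LinearIndependent ℝ ![y, v]) {F : E × E → ℝ} {c κ : ℝ} (hF : IsFinsler U F)
    (hflat : IsProjectivelyFlatProportional U F c) (hκ : HasConstantFlagCurvature U F κ) :
    κ = -c ^ 2 := by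
  obtain ⟨x, hx⟩ := hne
  obtain ⟨y, v, hyv⟩ := hE
  have hy : y ≠ 0 := by simpa using hyv.ne_zero 0
  have hz : ((x, y) : E × E) ∈ slit U := ⟨hx, hy⟩
  have hom : ∀ x ∈ U, ∀ y : E, y ≠ 0 → ∀ t : ℝ, 0 < t → F (x, t • y) = t * F (x, y) :=
    fun x hx y _ t ht => hF.homogeneous x hx y t ht
  have hB : ∀ z ∈ slit U, ∀ v : E, fderiv ℝ F z (v, 0) = 2 * c * F z * fderiv ℝ F z (0, v) :=
    fun z hz v => hflat.fderiv_horizontal hU hF.smooth hF.pos hom hz v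
  obtain ⟨G, hG, hJ⟩ := hκ
  have h1 := jacobiEndo_congr hU
    (hG.eqOn hF (isGeodesicSpray_of_fderiv_horizontal hU hF.smooth hom hB)) hz v
  rw [hJ _ hz, jacobiEndo_eq hU hF.smooth hom hB hz] at h1
  have h2 : (-((κ + c ^ 2) * (F (x, y) * fderiv ℝ F (x, y) (0, v)))) • y
      + ((κ + c ^ 2) * F (x, y) ^ 2) • v = 0 := by
    refine Eq.trans ?_ (sub_eq_zero.2 h1)
    dsimp only
    module
  have h3 := (LinearIndependent.pair_iff.1 hyv _ _ h2).2
  rcases mul_eq_zero.1 h3 with h4 | h4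
  · linarith
  · exact absurd h4 (pow_pos (hF.pos _ hz) 2).ne'

end General

/-! ### Randers metrics: nondegeneracy and the system for `g` and `β` -/

section Randers

variable {E : Type*} [NormedAddCommGroup E] [NormedSpace ℝ E]

/-- The function `√(g_x(y, y)) + β_x(y)`. -/
def randersFun (g : E → E →L[ℝ] E →L[ℝ] ℝ) (β : E → E →L[ℝ] ℝ) (z : E × E) : ℝ :=
  Real.sqrt (g z.1 z.2 z.2) + β z.1 z.2

/-- The data `(g, β)` of a Randers metric on `U`: a smooth Riemannian metric and a smooth
`1`-form of `g`-norm less than one. -/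
structure IsRandersData (U : Set E) (g : E → E →L[ℝ] E →L[ℝ] ℝ) (β : E → E →L[ℝ] ℝ) : Prop where
  isOpen : IsOpen U
  smooth_metric : ContDiffOn ℝ ∞ g U
  smooth_form : ContDiffOn ℝ ∞ β U
  symm : ∀ x ∈ U, ∀ v w : E, g x v w = g x w v
  pos : ∀ x ∈ U, ∀ v : E, v ≠ 0 → 0 < g x v v
  form_sq_lt : ∀ x ∈ U, ∀ v : E, v ≠ 0 → β x v ^ 2 < g x v v

namespace IsRandersData

variable {U : Set E} {g : E → E →L[ℝ] E →L[ℝ] ℝ} {β : E → E →L[ℝ] ℝ} (h : IsRandersData U g β)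

include h

theorem hasFDerivAt_metric {x : E} (hx : x ∈ U) : HasFDerivAt g (fderiv ℝ g x) x :=
  ((h.smooth_metric.contDiffAt (h.isOpen.mem_nhds hx)).differentiableAt (by simp)).hasFDerivAt

theorem hasFDerivAt_form {x : E} (hx : x ∈ U) : HasFDerivAt β (fderiv ℝ β x) x :=
  ((h.smooth_form.contDiffAt (h.isOpen.mem_nhds hx)).differentiableAt (by simp)).hasFDerivAt

theorem hasFDerivAt_metric_fst {z : E × E} (hz : z.1 ∈ U) :
    HasFDerivAt (fun z : E × E => g z.1)
      ((fderiv ℝ g z.1).comp (ContinuousLinearMap.fst ℝ E E)) z := by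
  have h1 : HasFDerivAt (Prod.fst : E × E → E) (ContinuousLinearMap.fst ℝ E E) z := hasFDerivAt_fst
  exact HasFDerivAt.comp (G := E →L[ℝ] E →L[ℝ] ℝ) z (h.hasFDerivAt_metric hz) h1

theorem hasFDerivAt_form_fst {z : E × E} (hz : z.1 ∈ U) :
    HasFDerivAt (fun z : E × E => β z.1)
      ((fderiv ℝ β z.1).comp (ContinuousLinearMap.fst ℝ E E)) z :=
  (h.hasFDerivAt_form hz).comp z hasFDerivAt_fst

theorem contDiffOn_metric_apply : ContDiffOn ℝ ∞ (fun z : E × E => g z.1 z.2 z.2)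
    (U ×ˢ Set.univ) := by
  have h1 : ContDiffOn ℝ ∞ (fun z : E × E => g z.1) (U ×ˢ Set.univ) :=
    h.smooth_metric.comp contDiffOn_fst fun z hz => hz.1
  exact (h1.clm_apply contDiffOn_snd).clm_apply contDiffOn_snd

theorem contDiffOn_form_apply : ContDiffOn ℝ ∞ (fun z : E × E => β z.1 z.2)
    (U ×ˢ Set.univ) := by
  have h1 : ContDiffOn ℝ ∞ (fun z : E × E => β z.1) (U ×ˢ Set.univ) :=
    h.smooth_form.comp contDiffOn_fst fun z hz => hz.1
  exact h1.clm_apply contDiffOn_snd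

theorem continuousOn_randersFun : ContinuousOn (randersFun g β) (U ×ˢ Set.univ) :=
  h.contDiffOn_metric_apply.continuousOn.sqrt.add h.contDiffOn_form_apply.continuousOn

omit [NormedSpace ℝ E] h in
theorem slit_subset : slit U ⊆ U ×ˢ Set.univ := fun _ hz => ⟨hz.1, Set.mem_univ _⟩

theorem contDiffOn_randersFun : ContDiffOn ℝ ∞ (randersFun g β) (slit U) :=
  ((h.contDiffOn_metric_apply.mono slit_subset).sqrt fun z hz => (h.pos z.1 hz.1 z.2 hz.2).ne').add
    (h.contDiffOn_form_apply.mono slit_subset)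

theorem sqrt_pos {z : E × E} (hz : z ∈ slit U) : 0 < Real.sqrt (g z.1 z.2 z.2) :=
  Real.sqrt_pos.2 (h.pos z.1 hz.1 z.2 hz.2)

theorem sq_sqrt {z : E × E} (hz : z ∈ slit U) :
    Real.sqrt (g z.1 z.2 z.2) ^ 2 = g z.1 z.2 z.2 :=
  Real.sq_sqrt (h.pos z.1 hz.1 z.2 hz.2).le

theorem randersFun_pos {z : E × E} (hz : z ∈ slit U) : 0 < randersFun g β z := by
  have h1 : |β z.1 z.2| < Real.sqrt (g z.1 z.2 z.2) :=
    Real.lt_sqrt_of_sq_lt (by rw [sq_abs]; exact h.form_sq_lt z.1 hz.1 z.2 hz.2)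
  have h2 := neg_abs_le (β z.1 z.2)
  rw [randersFun]; linarith

omit h in
theorem randersFun_smul (x y : E) (t : ℝ) (ht : 0 < t) :
    randersFun g β (x, t • y) = t * randersFun g β (x, y) := by
  simp only [randersFun, map_smul, smul_apply, smul_eq_mul]
  rw [show t * (t * g x y y) = t ^ 2 * g x y y by ring, Real.sqrt_mul (sq_nonneg t),
    Real.sqrt_sq ht.le]
  ring

theorem hasFDerivAt_metric_apply {z : E × E} (hz : z.1 ∈ U) : ∃ f : E × E →L[ℝ] ℝ,
    HasFDerivAt (fun z : E × E => g z.1 z.2 z.2) f z ∧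
    ∀ u v : E, f (u, v) = fderiv ℝ g z.1 u z.2 z.2 + 2 * g z.1 z.2 v := by
  have h1 := h.hasFDerivAt_metric_fst hz
  have h2 : HasFDerivAt (fun p : E × E => p.2) (ContinuousLinearMap.snd ℝ E E) z :=
    hasFDerivAt_snd
  refine ⟨_, (h1.clm_apply h2).clm_apply h2, fun u v => ?_⟩
  simp [h.symm z.1 hz v z.2]
  ring

theorem hasFDerivAt_form_apply {z : E × E} (hz : z.1 ∈ U) : ∃ f : E × E →L[ℝ] ℝ,
    HasFDerivAt (fun z : E × E => β z.1 z.2) f z ∧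
    ∀ u v : E, f (u, v) = fderiv ℝ β z.1 u z.2 + β z.1 v := by
  have h1 := h.hasFDerivAt_form_fst hz
  have h2 : HasFDerivAt (fun p : E × E => p.2) (ContinuousLinearMap.snd ℝ E E) z :=
    hasFDerivAt_snd
  refine ⟨_, h1.clm_apply h2, fun u v => ?_⟩
  simp
  ring

theorem fderiv_randersFun {z : E × E} (hz : z ∈ slit U) (u v : E) :
    fderiv ℝ (randersFun g β) z (u, v)
      = (fderiv ℝ g z.1 u z.2 z.2 + 2 * g z.1 z.2 v) / (2 * Real.sqrt (g z.1 z.2 z.2))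
        + (fderiv ℝ β z.1 u z.2 + β z.1 v) := by
  obtain ⟨f, hf, hf'⟩ := h.hasFDerivAt_metric_apply hz.1
  obtain ⟨k, hk, hk'⟩ := h.hasFDerivAt_form_apply hz.1
  have h1 : HasFDerivAt (randersFun g β) _ z := (hf.sqrt (h.pos z.1 hz.1 z.2 hz.2).ne').add hk
  rw [h1.fderiv]
  simp only [add_apply, smul_apply, smul_eq_mul, hf', hk']
  ring

theorem fderiv_vertical_randersFun {z : E × E} (hz : z ∈ slit U) (v : E) :
    fderiv ℝ (randersFun g β) z (0, v)
      = g z.1 z.2 v / Real.sqrt (g z.1 z.2 z.2) + β z.1 v := by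
  have := (h.sqrt_pos hz).ne'
  rw [h.fderiv_randersFun hz]
  simp only [map_zero, zero_apply, zero_add]
  field_simp

/-- The vertical Hessian of a Randers function. -/
theorem fderiv_fderiv_vertical_randersFun {z : E × E} (hz : z ∈ slit U) (v : E) :
    fderiv ℝ (fun p => fderiv ℝ (randersFun g β) p (0, v)) z (0, v)
      = (g z.1 v v * g z.1 z.2 z.2 - g z.1 z.2 v ^ 2) / Real.sqrt (g z.1 z.2 z.2) ^ 3 := by
  have h0 : (fun p => fderiv ℝ (randersFun g β) p (0, v)) =ᶠ[nhds z]
      fun p => g p.1 p.2 v * (Real.sqrt (g p.1 p.2 p.2))⁻¹ + β p.1 v := by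
    filter_upwards [(isOpen_slit h.isOpen).mem_nhds hz] with p hp
    rw [h.fderiv_vertical_randersFun hp, div_eq_mul_inv]
  obtain ⟨f, hf, hf'⟩ := h.hasFDerivAt_metric_apply hz.1
  have hg := h.hasFDerivAt_metric_fst hz.1
  have hβ := h.hasFDerivAt_form_fst hz.1
  have h2 : HasFDerivAt (fun p : E × E => p.2) (ContinuousLinearMap.snd ℝ E E) z :=
    hasFDerivAt_snd
  have hv := hasFDerivAt_const (𝕜 := ℝ) v z
  have hs := hf.sqrt (h.pos z.1 hz.1 z.2 hz.2).ne'
  have hi := (hasDerivAt_inv (h.sqrt_pos hz).ne').comp_hasFDerivAt z hs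
  have h3 : HasFDerivAt (fun p : E × E => g p.1 p.2 v * (Real.sqrt (g p.1 p.2 p.2))⁻¹ + β p.1 v)
    _ z := (((hg.clm_apply h2).clm_apply hv).mul hi).add (hβ.clm_apply hv)
  have hp := h.sqrt_pos hz
  have hq := h.sq_sqrt hz
  rw [h0.fderiv_eq, h3.fderiv]
  simp only [add_apply, smul_apply, smul_eq_mul, hf', ContinuousLinearMap.comp_apply,
    ContinuousLinearMap.flip_apply, ContinuousLinearMap.coe_snd', ContinuousLinearMap.coe_fst',
    map_zero, zero_apply, Function.comp_apply]
  set s := Real.sqrt (g z.1 z.2 z.2)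
  rw [← hq]
  field_simp
  ring

theorem cauchy_schwarz {x : E} (hx : x ∈ U) (y v : E) :
    g x y v ^ 2 ≤ g x v v * g x y y ∧
      (y ≠ 0 → g x v v * g x y y - g x y v ^ 2 = 0 → v = (g x y v / g x y y) • y) := by
  by_cases hy : y = 0
  · simp [hy]
  have hp := h.pos x hx y hy
  set t := g x y v / g x y y with ht
  have ht' : t * g x y y = g x y v := by rw [ht]; field_simp
  -- `t • y` is the `g`-orthogonal projection of `v` on `y`, so the defect in the inequality is the
  -- squared length of the remainder times `g(y, y)`.
  have e : g x (v - t • y) (v - t • y) * g x y y = g x v v * g x y y - g x y v ^ 2 := by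
    simp only [map_sub, map_smul, sub_apply, smul_apply, smul_eq_mul, h.symm x hx v y, ← ht']
    ring
  by_cases hv : v - t • y = 0
  · refine ⟨?_, fun _ _ => sub_eq_zero.1 hv⟩
    rw [hv] at e
    simp only [map_zero, zero_mul] at e
    linarith
  · have := mul_pos (h.pos x hx _ hv) hp
    exact ⟨by linarith, fun _ h0 => by linarith⟩

theorem isFinsler : IsFinsler U (randersFun g β) where
  continuousOn := h.continuousOn_randersFun
  smooth := h.contDiffOn_randersFun
  pos z hz := h.randersFun_pos hz
  homogeneous x _ y t ht := randersFun_smul x y t ht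
  nondegenerate z hz v hv := by
    have hF := h.contDiffOn_randersFun
    have dF := differentiableAt_of_mem_slit h.isOpen hF hz
    have dDF := differentiableAt_fderiv_of_mem_slit h.isOpen hF hz
    have hom : ∀ x ∈ U, ∀ y : E, y ≠ 0 → ∀ t : ℝ, 0 < t →
      randersFun g β (x, t • y) = t * randersFun g β (x, y) :=
      fun x _ y _ t ht => randersFun_smul x y t ht
    have h1 : (fun p => fderiv ℝ (fun q => randersFun g β q ^ 2) p (0, v)) =ᶠ[nhds z]
        fun p => 2 * randersFun g β p * fderiv ℝ (randersFun g β) p (0, v) := by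
      filter_upwards [(isOpen_slit h.isOpen).mem_nhds hz] with p hp
      exact fderiv_sq (differentiableAt_of_mem_slit h.isOpen hF hp) _
    have h2 : DifferentiableAt ℝ (fun p => fderiv ℝ (randersFun g β) p (0, v)) z :=
      dDF.clm_apply (differentiableAt_const _)
    have h3 : HasFDerivAt
        (fun p => 2 * randersFun g β p * fderiv ℝ (randersFun g β) p (0, v)) _ z :=
      (dF.hasFDerivAt.const_mul 2).mul h2.hasFDerivAt
    -- Testing against `w = v` suffices: it reads `F F_vv + F_v² = 0` with both terms nonnegative.
    -- Equality in Cauchy-Schwarz then gives `v = t y`, and `F_v = t F = 0` forces `t = 0`.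
    have h4 := hv v
    rw [metricTensor, h1.fderiv_eq, h3.fderiv] at h4
    simp only [add_apply, smul_apply, smul_eq_mul] at h4
    rw [h.fderiv_fderiv_vertical_randersFun hz] at h4
    obtain ⟨cs, eq⟩ := h.cauchy_schwarz hz.1 z.2 v
    have hpos := h.randersFun_pos hz
    have hs := pow_pos (h.sqrt_pos hz) 3
    set F := randersFun g β z
    set D := fderiv ℝ (randersFun g β) z (0, v) with hD
    set q := (g z.1 v v * g z.1 z.2 z.2 - g z.1 z.2 v ^ 2) / Real.sqrt (g z.1 z.2 z.2) ^ 3 with hqd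
    have hq : 0 ≤ q := div_nonneg (by linarith) hs.le
    have h5 : F * q + D ^ 2 = 0 := by linear_combination h4
    have h6 := mul_nonneg hpos.le hq
    have h7 : D = 0 := by
      have := sq_nonneg D
      exact pow_eq_zero_iff two_ne_zero |>.1 (by linarith)
    have h8 : q = 0 := by
      rcases mul_eq_zero.1 (show F * q = 0 by rw [h7] at h5; linarith) with h9 | h9
      · exact absurd h9 hpos.ne'
      · exact h9
    have h9 := eq hz.2 ((div_eq_zero_iff.1 h8).resolve_right hs.ne')
    set t := g z.1 z.2 v / g z.1 z.2 z.2
    have h10 : D = t * F := by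
      rw [hD, h9, show ((0, t • z.2) : E × E) = t • (0, z.2) by simp, map_smul,
        fderiv_vertical_self hz dF hom, smul_eq_mul]
    rcases mul_eq_zero.1 (h10.symm.trans h7) with h11 | h11
    · rw [h9, h11, zero_smul]
    · exact absurd h11 hpos.ne'

/-- Splitting `∂F/∂xʲ = 2 c F ∂F/∂yʲ` into its parts odd and even in `y`. -/
theorem fderiv_horizontal_iff (c : ℝ) :
    (∀ z ∈ slit U, ∀ v : E, fderiv ℝ (randersFun g β) z (v, 0)
      = 2 * c * randersFun g β z * fderiv ℝ (randersFun g β) z (0, v)) ↔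
    (∀ x ∈ U, ∀ u y : E, fderiv ℝ β x u y = 2 * c * (g x u y + β x u * β x y)) ∧
    (∀ x ∈ U, ∀ u y : E,
      fderiv ℝ g x u y y = 4 * c * (g x y y * β x u + g x u y * β x y)) := by
  have key : ∀ x ∈ U, ∀ y : E, y ≠ 0 → ∀ v : E,
      (fderiv ℝ (randersFun g β) (x, y) (v, 0)
      = 2 * c * randersFun g β (x, y) * fderiv ℝ (randersFun g β) (x, y) (0, v)) ↔
      fderiv ℝ g x v y y + 2 * Real.sqrt (g x y y) * fderiv ℝ β x v y
        = 4 * c * (g x y y * β x v + g x v y * β x y)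
          + 2 * Real.sqrt (g x y y) * (2 * c * (g x v y + β x v * β x y)) := by
    intro x hx y hy v
    have hz : ((x, y) : E × E) ∈ slit U := ⟨hx, hy⟩
    have hp := h.sqrt_pos hz
    have hq := h.sq_sqrt hz
    rw [h.fderiv_randersFun hz, h.fderiv_vertical_randersFun hz, randersFun, h.symm x hx v y]
    simp only [map_zero, mul_zero, add_zero] at hp hq ⊢
    set s := Real.sqrt (g x y y)
    rw [← hq]
    field_simp
    constructor <;> intro H <;> linear_combination H
  constructor
  · intro H
    have H1 : ∀ x ∈ U, ∀ u y : E, y ≠ 0 →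
        fderiv ℝ β x u y = 2 * c * (g x u y + β x u * β x y) ∧
        fderiv ℝ g x u y y = 4 * c * (g x y y * β x u + g x u y * β x y) := by
      intro x hx u y hy
      have e1 := (key x hx y hy u).1 (H (x, y) ⟨hx, hy⟩ u)
      -- Passing to `-y` fixes `√g(y, y)` and changes the sign of `β(y)`; the difference and the sum
      -- of the two equations give the two halves of the system.
      have e2 := (key x hx (-y) (neg_ne_zero.2 hy) u).1 (H (x, -y) ⟨hx, neg_ne_zero.2 hy⟩ u)
      simp only [map_neg, neg_apply, neg_neg] at e2
      have hz : ((x, y) : E × E) ∈ slit U := ⟨hx, hy⟩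
      have hp := h.sqrt_pos hz
      dsimp only at hp
      set s := Real.sqrt (g x y y)
      refine ⟨mul_left_cancel₀ hp.ne' ?_, ?_⟩
      · linear_combination (1 / 4) * e1 - (1 / 4) * e2
      · linear_combination (1 / 2) * e1 + (1 / 2) * e2
    refine ⟨fun x hx u y => ?_, fun x hx u y => ?_⟩ <;> by_cases hy : y = 0
    · simp [hy]
    · exact (H1 x hx u y hy).1
    · simp [hy]
    · exact (H1 x hx u y hy).2
  · rintro ⟨H1, H2⟩ ⟨x, y⟩ ⟨hx, hy⟩ v
    rw [key x hx y hy, H1 x hx, H2 x hx]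

end IsRandersData

theorem IsFinsler.congr {U : Set E} (hU : IsOpen U) {F F' : E × E → ℝ} (hF : IsFinsler U F)
    (h : Set.EqOn F' F (U ×ˢ Set.univ)) : IsFinsler U F' := by
  have hs : Set.EqOn F' F (slit U) := h.mono IsRandersData.slit_subset
  have hx' : ∀ x ∈ U, ∀ y, F' (x, y) = F (x, y) := fun x hx y =>
    h (⟨hx, Set.mem_univ _⟩ : (x, y) ∈ U ×ˢ Set.univ)
  refine ⟨hF.continuousOn.congr h, hF.smooth.congr hs, fun z hz => ?_, fun x hx y t ht => ?_,
    fun z hz v hv => hF.nondegenerate z hz v fun w => ?_⟩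
  · rw [hs hz]; exact hF.pos z hz
  · rw [hx' x hx, hx' x hx]; exact hF.homogeneous x hx y t ht
  · rw [← hv w, metricTensor, metricTensor]
    have hsq : Set.EqOn (fun q => F' q ^ 2) (fun q => F q ^ 2) (slit U) := fun p hp => by
      simp only [hs hp]
    have h1 : (fun p => fderiv ℝ (fun q => F' q ^ 2) p (0, w)) =ᶠ[nhds z]
        fun p => fderiv ℝ (fun q => F q ^ 2) p (0, w) := by
      filter_upwards [(isOpen_slit hU).mem_nhds hz] with p hp
      rw [(Filter.eventuallyEq_of_mem ((isOpen_slit hU).mem_nhds hp) hsq).fderiv_eq]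
    rw [h1.fderiv_eq]

/-- A Randers metric `√g + β` is projectively flat with projective factor `c F` and of negative
constant flag curvature exactly when `β` and `g` solve a first order system. -/
theorem isProportionalRanders_iff {U : Set E} (hU : IsOpen U) (hne : U.Nonempty)
    (hE : ∃ y v : E, LinearIndependent ℝ ![y, v]) (a b : E × E → ℝ) (c κ : ℝ) :
    IsProportionalRanders U a b c κ ↔ c ≠ 0 ∧ κ = -c ^ 2 ∧
      ∃ (g : E → E →L[ℝ] E →L[ℝ] ℝ) (β : E → E →L[ℝ] ℝ), IsRandersData U g β ∧
        (∀ x ∈ U, ∀ y, a (x, y) = Real.sqrt (g x y y)) ∧ (∀ x ∈ U, ∀ y, b (x, y) = β x y) ∧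
        (∀ x ∈ U, ∀ u y : E, fderiv ℝ β x u y = 2 * c * (g x u y + β x u * β x y)) ∧
        (∀ x ∈ U, ∀ u y : E,
          fderiv ℝ g x u y y = 4 * c * (g x y y * β x u + g x u y * β x y)) := by
  have transfer : ∀ {F F' : E × E → ℝ}, Set.EqOn F F' (slit U) →
      (∀ z ∈ slit U, ∀ v : E, fderiv ℝ F z (v, 0) = 2 * c * F z * fderiv ℝ F z (0, v)) →
      ∀ z ∈ slit U, ∀ v : E, fderiv ℝ F' z (v, 0) = 2 * c * F' z * fderiv ℝ F' z (0, v) := by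
    intro F F' hFF h z hz v
    rw [← (Filter.eventuallyEq_of_mem ((isOpen_slit hU).mem_nhds hz) hFF).fderiv_eq, ← hFF hz]
    exact h z hz v
  constructor
  · rintro ⟨⟨⟨g, hg, hsymm, hpos, ha⟩, ⟨β, hβ, hb⟩, hF⟩, hflat, hcurv, hneg⟩
    have hκ := flagCurvature_eq hU hne hE hF hflat hcurv
    refine ⟨fun hc => by simp [hκ, hc] at hneg, hκ, g, β, ?_⟩
    have hd : IsRandersData U g β := by
      refine ⟨hU, hg, hβ, hsymm, hpos, fun x hx v hv => ?_⟩
      -- Positivity of `F` at both `v` and `-v` is exactly `|β(v)| < √g(v, v)`.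
      have h1 := hF.pos (x, v) ⟨hx, hv⟩
      have h2 := hF.pos (x, -v) ⟨hx, neg_ne_zero.2 hv⟩
      simp only [Pi.add_apply, ha x hx, hb x hx, map_neg, neg_apply, neg_neg] at h1 h2
      rw [← sq_abs, ← Real.lt_sqrt (abs_nonneg _), abs_lt]
      constructor <;> linarith
    refine ⟨hd, ha, hb, (hd.fderiv_horizontal_iff c).1 (transfer (F := a + b) ?_ ?_)⟩
    · rintro ⟨x, y⟩ ⟨hx, -⟩
      simp only [Pi.add_apply, ha x hx, hb x hx, randersFun]
    · exact fun z hz v => hflat.fderiv_horizontal hU hF.smooth hF.pos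
        (fun x hx y _ t ht => hF.homogeneous x hx y t ht) hz v
  · rintro ⟨hc, rfl, g, β, hd, ha, hb, h1, h2⟩
    have heq : Set.EqOn (a + b) (randersFun g β) (U ×ˢ Set.univ) := by
      rintro ⟨x, y⟩ ⟨hx, -⟩
      simp only [Pi.add_apply, ha x hx, hb x hx, randersFun]
    have hF : IsFinsler U (a + b) := hd.isFinsler.congr hU heq
    have hom : ∀ x ∈ U, ∀ y : E, y ≠ 0 → ∀ t : ℝ, 0 < t →
        (a + b) (x, t • y) = t * (a + b) (x, y) := fun x hx y _ t ht => hF.homogeneous x hx y t ht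
    have hB := transfer (F' := a + b) (heq.symm.mono IsRandersData.slit_subset)
      ((hd.fderiv_horizontal_iff c).2 ⟨h1, h2⟩)
    have hG := isGeodesicSpray_of_fderiv_horizontal hU hF.smooth hom hB
    refine ⟨⟨⟨g, hd.smooth_metric, hd.symm, hd.pos, ha⟩, ⟨β, hd.smooth_form, hb⟩, hF⟩,
      ⟨fun z => c * (a + b) z, ⟨contDiffOn_const.mul hF.smooth, fun x hx y hy t ht => ?_, hG⟩,
        fun _ _ => rfl⟩,
      ⟨_, hG, fun z hz v => jacobiEndo_eq hU hF.smooth hom hB hz v⟩, ?_⟩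
    · rw [hom x hx y hy t ht]; ring
    · have := sq_pos_of_ne_zero hc
      linarith

end Randers

/-! ### The model family and its affine pullbacks -/

section Models

variable {n : ℕ}

theorem exists_linearIndependent_pair (hn : 2 ≤ n) :
    ∃ y v : EuclideanSpace ℝ (Fin n), LinearIndependent ℝ ![y, v] := by
  have : Nontrivial (EuclideanSpace ℝ (Fin n)) :=
    Module.nontrivial_of_finrank_pos (R := ℝ) (by rw [finrank_euclideanSpace_fin]; omega)
  obtain ⟨y, hy⟩ := exists_ne (0 : EuclideanSpace ℝ (Fin n))
  exact ⟨y, exists_linearIndependent_pair_of_one_lt_finrank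
    (by rw [finrank_euclideanSpace_fin]; omega) hy⟩

theorem fderiv_clm_apply_const {E F : Type*} [NormedAddCommGroup E] [NormedSpace ℝ E]
    [NormedAddCommGroup F] [NormedSpace ℝ F] {f : E → E →L[ℝ] F} {x : E}
    (hf : DifferentiableAt ℝ f x) (u y : E) :
    fderiv ℝ (fun p => f p y) x u = fderiv ℝ f x u y := by
  rw [fderiv_clm_apply hf (differentiableAt_const y)]; simp

theorem fderiv_clm_apply_const₂ {E : Type*} [NormedAddCommGroup E] [NormedSpace ℝ E]
    {f : E → E →L[ℝ] E →L[ℝ] ℝ} {x : E} (hf : DifferentiableAt ℝ f x) (u y w : E) :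
    fderiv ℝ (fun p => f p y w) x u = fderiv ℝ f x u y w := by
  rw [fderiv_clm_apply_const (hf.clm_apply (differentiableAt_const y)),
    fderiv_clm_apply_const hf]

theorem contDiffOn_smul_const {E F : Type*} [NormedAddCommGroup E] [NormedSpace ℝ E]
    [NormedAddCommGroup F] [NormedSpace ℝ F] {U : Set E} {f : E → ℝ} (hf : ContDiffOn ℝ ∞ f U)
    (v : F) : ContDiffOn ℝ ∞ (fun x => f x • v) U :=
  hf.smul contDiffOn_const

section Pullback

variable {E W : Type*} [NormedAddCommGroup E] [NormedSpace ℝ E]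
  [NormedAddCommGroup W] [InnerProductSpace ℝ W]

/-- The pullback of the `1`-form of the model by `x ↦ L x + p`. -/
def modelForm (c : ℝ) (L : E →L[ℝ] W) (p : W) (x : E) : E →L[ℝ] ℝ :=
  (2 * c / (1 - 4 * c ^ 2 * ‖L x + p‖ ^ 2)) • (innerSL ℝ (L x + p)).comp L

/-- The pullback of the inner product by a continuous linear map. -/
def pullbackInner (L : E →L[ℝ] W) : E →L[ℝ] E →L[ℝ] ℝ :=
  (isBoundedBilinearMap_inner (𝕜 := ℝ) (E := W)).toContinuousLinearMap.bilinearComp L L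

/-- The pullback of the Riemannian metric of the model by `x ↦ L x + p`. -/
def modelMetric (c : ℝ) (L : E →L[ℝ] W) (p : W) (x : E) : E →L[ℝ] E →L[ℝ] ℝ :=
  (1 - 4 * c ^ 2 * ‖L x + p‖ ^ 2)⁻¹ • pullbackInner L
    + (modelForm c L p x).smulRight (modelForm c L p x)

variable (c : ℝ) (L : E →L[ℝ] W) (p : W)

theorem modelForm_apply (x v : E) : modelForm c L p x v
    = 2 * c * inner ℝ (L x + p) (L v) / (1 - 4 * c ^ 2 * ‖L x + p‖ ^ 2) := by
  simp only [modelForm, smul_apply, ContinuousLinearMap.comp_apply, innerSL_apply_apply,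
    smul_eq_mul]
  ring

theorem modelMetric_apply (x v w : E) : modelMetric c L p x v w
    = inner ℝ (L v) (L w) / (1 - 4 * c ^ 2 * ‖L x + p‖ ^ 2)
      + modelForm c L p x v * modelForm c L p x w := by
  simp [modelMetric, pullbackInner, div_eq_inv_mul]

variable {c L p} {U : Set E} (hU : IsOpen U) (hφ : ∀ x ∈ U, 4 * c ^ 2 * ‖L x + p‖ ^ 2 < 1)

include hφ

theorem contDiffOn_modelForm : ContDiffOn ℝ ∞ (modelForm c L p) U := by
  have hL : ContDiff ℝ ∞ fun x => L x + p := L.contDiff.add contDiff_const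
  have h1 : ContDiff ℝ ∞ fun x => 1 - 4 * c ^ 2 * ‖L x + p‖ ^ 2 :=
    contDiff_const.sub (contDiff_const.mul (hL.norm_sq ℝ))
  have h2 : ContDiff ℝ ∞ fun x => (innerSL ℝ (L x + p)).comp L :=
    ((innerSL ℝ).contDiff.comp hL).clm_comp contDiff_const
  exact (contDiffOn_const.div h1.contDiffOn fun x hx => by linarith [hφ x hx]).smul h2.contDiffOn

theorem contDiffOn_modelMetric : ContDiffOn ℝ ∞ (modelMetric c L p) U := by
  have hL : ContDiff ℝ ∞ fun x => L x + p := L.contDiff.add contDiff_const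
  have h1 : ContDiff ℝ ∞ fun x => 1 - 4 * c ^ 2 * ‖L x + p‖ ^ 2 :=
    contDiff_const.sub (contDiff_const.mul (hL.norm_sq ℝ))
  have h2 := contDiffOn_modelForm hφ
  have h3 : ∀ x ∈ U, 1 - 4 * c ^ 2 * ‖L x + p‖ ^ 2 ≠ 0 := fun x hx => by linarith [hφ x hx]
  have h4 : ContDiffOn ℝ ∞ (fun x => (1 - 4 * c ^ 2 * ‖L x + p‖ ^ 2)⁻¹ • pullbackInner L) U :=
    contDiffOn_smul_const (h1.contDiffOn.inv h3) _
  exact h4.add (h2.smulRight h2)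

include hU

theorem isRandersData_model (hL : Function.Injective L) :
    IsRandersData U (modelMetric c L p) (modelForm c L p) where
  isOpen := hU
  smooth_metric := contDiffOn_modelMetric hφ
  smooth_form := contDiffOn_modelForm hφ
  symm x _ v w := by rw [modelMetric_apply, modelMetric_apply, real_inner_comm]; ring
  pos x hx v hv := by
    have h1 : 0 < 1 - 4 * c ^ 2 * ‖L x + p‖ ^ 2 := by linarith [hφ x hx]
    have h2 : L v ≠ 0 := fun h => hv (hL (by rw [h, map_zero]))
    rw [modelMetric_apply, real_inner_self_eq_norm_sq]
    have h3 := norm_pos_iff.2 h2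
    have := mul_self_nonneg (modelForm c L p x v)
    positivity
  form_sq_lt x hx v hv := by
    have h1 : 0 < 1 - 4 * c ^ 2 * ‖L x + p‖ ^ 2 := by linarith [hφ x hx]
    have h2 : L v ≠ 0 := fun h => hv (hL (by rw [h, map_zero]))
    have h3 := norm_pos_iff.2 h2
    rw [modelMetric_apply, real_inner_self_eq_norm_sq, ← sq, lt_add_iff_pos_left]
    positivity

omit hU hφ in
theorem hasFDerivAt_modelDenom (x : E) : ∃ f : E →L[ℝ] ℝ,
    HasFDerivAt (fun x => 1 - 4 * c ^ 2 * ‖L x + p‖ ^ 2) f x ∧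
    ∀ u, f u = -(8 * c ^ 2 * inner ℝ (L x + p) (L u)) := by
  have hL : HasFDerivAt (fun x => L x + p) L x := L.hasFDerivAt.add_const p
  refine ⟨_, (hL.norm_sq.const_mul (4 * c ^ 2)).const_sub 1, fun u => ?_⟩
  simp [inner_add_left]
  ring

theorem fderiv_modelForm {x : E} (hx : x ∈ U) (u y : E) :
    fderiv ℝ (modelForm c L p) x u y
      = 2 * c * (modelMetric c L p x u y + modelForm c L p x u * modelForm c L p x y) := by
  have hd : DifferentiableAt ℝ (modelForm c L p) x :=
    ((contDiffOn_modelForm hφ).contDiffAt (hU.mem_nhds hx)).differentiableAt (by simp)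
  have h1 : 1 - 4 * c ^ 2 * ‖L x + p‖ ^ 2 ≠ 0 := by linarith [hφ x hx]
  obtain ⟨f, hf, hf'⟩ := hasFDerivAt_modelDenom (c := c) (L := L) (p := p) x
  have hL : HasFDerivAt (fun x => L x + p) L x := L.hasFDerivAt.add_const p
  have h2 : HasFDerivAt (fun x => 2 * c * inner ℝ (L x + p) (L y)
      * (1 - 4 * c ^ 2 * ‖L x + p‖ ^ 2)⁻¹) _ x :=
    ((hL.inner ℝ (hasFDerivAt_const (L y) x)).const_mul (2 * c)).mul
      ((hasDerivAt_inv h1).comp_hasFDerivAt x hf)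
  have h3 : (fun x => modelForm c L p x y) = fun x => 2 * c * inner ℝ (L x + p) (L y)
      * (1 - 4 * c ^ 2 * ‖L x + p‖ ^ 2)⁻¹ := by
    ext x; rw [modelForm_apply, div_eq_mul_inv]
  rw [← fderiv_clm_apply_const hd, h3, h2.fderiv, modelMetric_apply,
    modelForm_apply, modelForm_apply]
  simp only [add_apply, smul_apply, smul_eq_mul, hf', ContinuousLinearMap.comp_apply,
    ContinuousLinearMap.prod_apply, fderivInnerCLM_apply, zero_apply, inner_zero_right,
    zero_add]
  field_simp
  ring

theorem fderiv_modelMetric {x : E} (hx : x ∈ U) (u y : E) :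
    fderiv ℝ (modelMetric c L p) x u y y
      = 4 * c * (modelMetric c L p x y y * modelForm c L p x u
        + modelMetric c L p x u y * modelForm c L p x y) := by
  have hd : DifferentiableAt ℝ (modelForm c L p) x :=
    ((contDiffOn_modelForm hφ).contDiffAt (hU.mem_nhds hx)).differentiableAt (by simp)
  have hd' : DifferentiableAt ℝ (modelMetric c L p) x :=
    ((contDiffOn_modelMetric hφ).contDiffAt (hU.mem_nhds hx)).differentiableAt (by simp)
  have h1 : 1 - 4 * c ^ 2 * ‖L x + p‖ ^ 2 ≠ 0 := by linarith [hφ x hx]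
  obtain ⟨f, hf, hf'⟩ := hasFDerivAt_modelDenom (c := c) (L := L) (p := p) x
  have hβ : HasFDerivAt (fun x => modelForm c L p x y) _ x :=
    (hd.clm_apply (differentiableAt_const y)).hasFDerivAt
  have h2 : HasFDerivAt (fun x => inner ℝ (L y) (L y) * (1 - 4 * c ^ 2 * ‖L x + p‖ ^ 2)⁻¹
      + modelForm c L p x y * modelForm c L p x y) _ x :=
    (((hasDerivAt_inv h1).comp_hasFDerivAt x hf).const_mul (inner ℝ (L y) (L y))).add (hβ.mul hβ)
  have h3 : (fun x => modelMetric c L p x y y) = fun x => inner ℝ (L y) (L y)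
      * (1 - 4 * c ^ 2 * ‖L x + p‖ ^ 2)⁻¹ + modelForm c L p x y * modelForm c L p x y := by
    ext x; rw [modelMetric_apply, div_eq_mul_inv]
  have h4 := fderiv_modelForm hU hφ hx u y
  -- For `ρ = 1 - 4 c² |L x + p|²` this says `dρ = -4 c ρ β`, the source of the term `4 c g(y, y)
  -- β(u)`.
  have h5 : 8 * c ^ 2 * inner ℝ (L x + p) (L u)
      = 4 * c * modelForm c L p x u * (1 - 4 * c ^ 2 * ‖L x + p‖ ^ 2) := by
    have : modelForm c L p x u * (1 - 4 * c ^ 2 * ‖L x + p‖ ^ 2)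
        = 2 * c * inner ℝ (L x + p) (L u) := by
      rw [modelForm_apply, div_mul_cancel₀ _ h1]
    linear_combination (-4 * c) * this
  rw [← fderiv_clm_apply_const₂ hd', h3, h2.fderiv]
  simp only [add_apply, smul_apply, smul_eq_mul, hf', fderiv_clm_apply_const hd, h4, h5]
  simp only [modelMetric_apply]
  field_simp
  ring

end Pullback

theorem modelB_eq (c : ℝ) (x y : EuclideanSpace ℝ (Fin n)) :
    modelB c (x, y) = 2 * c * inner ℝ x y / (1 - 4 * c ^ 2 * ‖x‖ ^ 2) := rfl

/-- The identity `a² = |y|² / ρ + b²`, with `ρ = 1 - 4 c² |x|²`, explains the shape of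
`modelMetric`; positivity of `ρ` in the ball allows the denominator to move under the root. -/
theorem modelA_eq_sqrt {c : ℝ} {x : EuclideanSpace ℝ (Fin n)} (hx : x ∈ modelBall n c)
    (y : EuclideanSpace ℝ (Fin n)) :
    modelA c (x, y)
      = Real.sqrt (‖y‖ ^ 2 / (1 - 4 * c ^ 2 * ‖x‖ ^ 2) + modelB c (x, y) ^ 2) := by
  have h1 : 0 < 1 - 4 * c ^ 2 * ‖x‖ ^ 2 := sub_pos.2 hx
  have h2 : ‖y‖ ^ 2 / (1 - 4 * c ^ 2 * ‖x‖ ^ 2) + modelB c (x, y) ^ 2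
      = (‖y‖ ^ 2 - 4 * c ^ 2 * (‖x‖ ^ 2 * ‖y‖ ^ 2 - inner ℝ x y ^ 2))
        / (1 - 4 * c ^ 2 * ‖x‖ ^ 2) ^ 2 := by
    rw [modelB_eq]; field_simp; ring
  rw [h2, Real.sqrt_div' _ (sq_nonneg _), Real.sqrt_sq h1.le, modelA]

theorem isProportionalRanders_of_model (hn : 2 ≤ n) {U : Set (EuclideanSpace ℝ (Fin n))}
    (hU : IsOpen U) (hne : U.Nonempty)
    {a b : EuclideanSpace ℝ (Fin n) × EuclideanSpace ℝ (Fin n) → ℝ} {c : ℝ} (hc : c ≠ 0)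
    (φ : EuclideanSpace ℝ (Fin n) ≃ᵃ[ℝ] EuclideanSpace ℝ (Fin n))
    (hφ : ∀ x ∈ U, φ x ∈ modelBall n c)
    (hab : ∀ x ∈ U, ∀ y, a (x, y) = modelA c (φ x, φ.linear y) ∧
      b (x, y) = modelB c (φ x, φ.linear y)) :
    IsProportionalRanders U a b c (-c ^ 2) := by
  let L : EuclideanSpace ℝ (Fin n) →L[ℝ] EuclideanSpace ℝ (Fin n) :=
    LinearMap.toContinuousLinearMap (φ.linear : _ →ₗ[ℝ] _)
  have hLφ : ∀ x, φ x = L x + φ 0 := fun x => by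
    have := φ.map_vadd 0 x
    simpa [L] using this
  have hball : ∀ x ∈ U, 4 * c ^ 2 * ‖L x + φ 0‖ ^ 2 < 1 := fun x hx => by
    rw [← hLφ]; exact hφ x hx
  have hB : ∀ x y, modelB c (φ x, φ.linear y) = modelForm c L (φ 0) x y := fun x y => by
    rw [modelForm_apply, modelB_eq, hLφ]; rfl
  refine (isProportionalRanders_iff hU hne (exists_linearIndependent_pair hn) a b c _).2
    ⟨hc, rfl, modelMetric c L (φ 0), modelForm c L (φ 0),
      isRandersData_model hU hball φ.linear.injective, fun x hx y => ?_, fun x hx y => ?_,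
      fun x hx => fderiv_modelForm hU hball hx, fun x hx => fderiv_modelMetric hU hball hx⟩
  · rw [(hab x hx y).1, modelA_eq_sqrt (hφ x hx), modelMetric_apply, hB,
      real_inner_self_eq_norm_sq, hLφ, sq (modelForm c L (φ 0) x y)]
    rfl
  · rw [(hab x hx y).2, hB]

theorem isOpen_modelBall (c : ℝ) : IsOpen (modelBall n c) :=
  isOpen_lt (by fun_prop) continuous_const

theorem isProportionalRanders_of_subset_modelBall (hn : 2 ≤ n)
    {U : Set (EuclideanSpace ℝ (Fin n))} (hU : IsOpen U) (hne : U.Nonempty)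
    {a b : EuclideanSpace ℝ (Fin n) × EuclideanSpace ℝ (Fin n) → ℝ} {c : ℝ} (hc : c ≠ 0)
    (hball : U ⊆ modelBall n c)
    (hab : ∀ x ∈ U, ∀ y, a (x, y) = modelA c (x, y) ∧ b (x, y) = modelB c (x, y)) :
    IsProportionalRanders U a b c (-c ^ 2) :=
  isProportionalRanders_of_model hn hU hne hc (AffineEquiv.refl ℝ _) hball hab

end Models

/-- A positive definite symmetric bilinear form on an `n`-dimensional space is the pullback of
the Euclidean inner product by a linear isomorphism. -/
theorem exists_linearEquiv_inner_eq {V : Type*} [AddCommGroup V] [Module ℝ V]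
    [FiniteDimensional ℝ V] {n : ℕ} (hV : Module.finrank ℝ V = n) (B : V →ₗ[ℝ] V →ₗ[ℝ] ℝ)
    (hsymm : ∀ v w, B v w = B w v) (hpos : ∀ v, v ≠ 0 → 0 < B v v) :
    ∃ L : V ≃ₗ[ℝ] EuclideanSpace ℝ (Fin n), ∀ v w, inner ℝ (L v) (L w) = B v w := by
  -- The form `B` itself serves as the inner product; coordinates in an orthonormal basis for it
  -- give the isomorphism.
  let core : InnerProductSpace.Core ℝ V :=
    { inner := fun v w => B v w
      conj_inner_symm := fun v w => by simpa using hsymm w v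
      re_inner_nonneg := fun v => by
        by_cases hv : v = 0
        · simp [hv]
        · simpa using (hpos v hv).le
      add_left := fun u v w => by simp
      smul_left := fun u v r => by simp
      definite := fun v hv => by
        by_contra h
        exact (hpos v h).ne' hv }
  let : NormedAddCommGroup V := core.toNormedAddCommGroup
  let : InnerProductSpace ℝ V := InnerProductSpace.ofCore core.toCore
  subst hV
  exact ⟨(stdOrthonormalBasis ℝ V).repr.toLinearEquiv, fun v w =>
    (stdOrthonormalBasis ℝ V).repr.inner_map_map v w⟩

/-! ### Integration of the system on a convex domain -/

section Classification

variable {n : ℕ} {U : Set (EuclideanSpace ℝ (Fin n))}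
  {g : EuclideanSpace ℝ (Fin n) → EuclideanSpace ℝ (Fin n) →L[ℝ] EuclideanSpace ℝ (Fin n) →L[ℝ] ℝ}
  {β : EuclideanSpace ℝ (Fin n) → EuclideanSpace ℝ (Fin n) →L[ℝ] ℝ} {c : ℝ}

theorem eq_of_hasFDerivAt_zero {E : Type*} [NormedAddCommGroup E] [NormedSpace ℝ E] {U : Set E}
    (hU : IsOpen U) (hconv : Convex ℝ U) {f : E → ℝ}
    (hf : ∀ x ∈ U, ∃ f' : E →L[ℝ] ℝ, HasFDerivAt f f' x ∧ ∀ u, f' u = 0)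
    {x y : E} (hx : x ∈ U) (hy : y ∈ U) : f x = f y := by
  refine hU.is_const_of_fderiv_eq_zero (𝕜 := ℝ) hconv.isPreconnected (fun x hx => ?_)
    (fun x hx => ?_) hx hy
  · obtain ⟨f', h, -⟩ := hf x hx
    exact h.differentiableAt.differentiableWithinAt
  · obtain ⟨f', h, h0⟩ := hf x hx
    rw [h.fderiv]
    ext u
    simp [h0]

/-- The system is integrated through three quantities with zero derivative on `U`: `ψ (g - β ⊗ β)`,
then `ψ β - 2 c Q(x, ·)`, then `ψ + 4 c² Q(x - x₁, x - x₁)`. -/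
theorem exists_affineEquiv_of_system (hconv : Convex ℝ U) (hne : U.Nonempty)
    (hc : c ≠ 0) (hd : IsRandersData U g β)
    (h1 : ∀ x ∈ U, ∀ u y, fderiv ℝ β x u y = 2 * c * (g x u y + β x u * β x y))
    (h2 : ∀ x ∈ U, ∀ u y, fderiv ℝ g x u y y = 4 * c * (g x y y * β x u + g x u y * β x y)) :
    ∃ φ : EuclideanSpace ℝ (Fin n) ≃ᵃ[ℝ] EuclideanSpace ℝ (Fin n),
      (∀ x ∈ U, φ x ∈ modelBall n c) ∧ ∀ x ∈ U, ∀ y,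
        Real.sqrt (g x y y) = modelA c (φ x, φ.linear y) ∧
        β x y = modelB c (φ x, φ.linear y) := by
  have hU := hd.isOpen
  obtain ⟨x₀, hx₀⟩ := hne
  -- The formula for `Dβ` is symmetric in its two arguments, so `β` is closed and has a potential
  -- `f` on the convex set.
  obtain ⟨f, hf⟩ := hconv.exists_forall_hasFDerivAt_of_fderiv_symmetric hU
    (hd.smooth_form.differentiableOn (by simp)) fun x hx u y => by
      rw [h1 x hx, h1 x hx, hd.symm x hx]; ring
  -- The exponent cancels the growth of `g - β ⊗ β`, whose derivative along `u` is `4 c β(u)` times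
  -- itself.
  set ψ : EuclideanSpace ℝ (Fin n) → ℝ := fun x => Real.exp (-4 * c * f x) with hψ
  have ψpos : ∀ x, 0 < ψ x := fun x => Real.exp_pos _
  have dψ : ∀ x ∈ U, HasFDerivAt ψ (ψ x • ((-4 * c) • β x)) x := fun x hx =>
    ((hf x hx).const_mul (-4 * c)).exp
  have dβ : ∀ x ∈ U, ∀ y, HasFDerivAt (fun x => β x y) (fderiv ℝ (fun x => β x y) x) x :=
    fun x hx y => ((hd.hasFDerivAt_form hx).differentiableAt.clm_apply
      (differentiableAt_const y)).hasFDerivAt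
  have dg : ∀ x ∈ U, ∀ y, HasFDerivAt (fun x => g x y y) (fderiv ℝ (fun x => g x y y) x) x :=
    fun x hx y => (((hd.hasFDerivAt_metric hx).differentiableAt.clm_apply
      (differentiableAt_const y)).clm_apply (differentiableAt_const y)).hasFDerivAt
  have eβ : ∀ x ∈ U, ∀ y u, fderiv ℝ (fun x => β x y) x u
      = 2 * c * (g x u y + β x u * β x y) := fun x hx y u => by
    rw [fderiv_clm_apply_const (hd.hasFDerivAt_form hx).differentiableAt, h1 x hx]
  have eg : ∀ x ∈ U, ∀ y u, fderiv ℝ (fun x => g x y y) x u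
      = 4 * c * (g x y y * β x u + g x u y * β x y) := fun x hx y u => by
    rw [fderiv_clm_apply_const₂ (hd.hasFDerivAt_metric hx).differentiableAt, h2 x hx]
  set Q := ψ x₀ • (g x₀ - (β x₀).smulRight (β x₀)) with hQ
  have Q_apply : ∀ v w, Q v w = ψ x₀ * (g x₀ v w - β x₀ v * β x₀ w) := fun v w => by
    simp [hQ]
  have Q_symm : ∀ v w, Q v w = Q w v := fun v w => by
    rw [Q_apply, Q_apply, hd.symm x₀ hx₀]; ring
  have Q_pos : ∀ v, v ≠ 0 → 0 < Q v v := fun v hv => by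
    rw [Q_apply]
    exact mul_pos (ψpos _) (by linarith [hd.form_sq_lt x₀ hx₀ v hv])
  -- the Hessian of `ψ` is the constant form `-8 c² Q`
  have Q_diag : ∀ x ∈ U, ∀ y, ψ x * (g x y y - β x y * β x y) = Q y y := by
    intro x hx y
    rw [Q_apply]
    refine eq_of_hasFDerivAt_zero hU hconv (f := fun x => ψ x * (g x y y - β x y * β x y))
      (fun x hx => ⟨_, (dψ x hx).mul ((dg x hx y).sub ((dβ x hx y).mul (dβ x hx y))),
        fun u => ?_⟩) hx hx₀
    simp only [add_apply, sub_apply, smul_apply, smul_eq_mul, eβ x hx, eg x hx]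
    ring
  have Q_eq : ∀ x ∈ U, ∀ v w, ψ x * (g x v w - β x v * β x w) = Q v w := by
    intro x hx v w
    have e1 := Q_diag x hx (v + w)
    have e2 := Q_diag x hx v
    have e3 := Q_diag x hx w
    simp only [map_add, add_apply, hd.symm x hx w v, Q_symm w v] at e1
    linear_combination (1 / 2) * (e1 - e2 - e3)
  let B : EuclideanSpace ℝ (Fin n) →ₗ[ℝ] EuclideanSpace ℝ (Fin n) →ₗ[ℝ] ℝ :=
    LinearMap.mk₂ ℝ (fun v w => Q v w) (by simp) (by simp) (by simp) (by simp)
  have B_inj : Function.Injective B := by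
    rw [injective_iff_map_eq_zero]
    intro v hv
    by_contra h
    have : B v v = 0 := by rw [hv]; rfl
    exact (Q_pos v h).ne' this
  have B_surj : Function.Surjective B :=
    (LinearMap.injective_iff_surjective_of_finrank_eq_finrank
      (Subspace.dual_finrank_eq (K := ℝ)).symm).1 B_inj
  -- the critical point of the quadratic polynomial `ψ`
  obtain ⟨x₁, hx₁⟩ := B_surj
    ((8 * c ^ 2)⁻¹ • (((-4 * c * ψ x₀) • β x₀ + (8 * c ^ 2) • Q x₀ :
      EuclideanSpace ℝ (Fin n) →L[ℝ] ℝ) : EuclideanSpace ℝ (Fin n) →ₗ[ℝ] ℝ))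
  have hc2 : 0 < c ^ 2 := sq_pos_of_ne_zero hc
  -- Equivalently `ψ β = 2 c Q(x₀ - x₁, ·)` at `x₀`, which fixes the integration constant in `grad`.
  -- The point `x₁` need not lie in `U`.
  have Q_x₁ : ∀ y, 8 * c ^ 2 * Q x₁ y = -4 * c * ψ x₀ * β x₀ y + 8 * c ^ 2 * Q x₀ y := by
    intro y
    have : Q x₁ y = (8 * c ^ 2)⁻¹ * (-4 * c * ψ x₀ * β x₀ y + 8 * c ^ 2 * Q x₀ y) := by
      have := LinearMap.congr_fun hx₁ y
      simp only [B, LinearMap.mk₂_apply] at this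
      exact this
    rw [this]; field_simp
  have grad : ∀ x ∈ U, ∀ y, ψ x * β x y = 2 * c * Q (x - x₁) y := by
    intro x hx y
    have dQ : ∀ x, HasFDerivAt (fun x => Q x y) _ x := fun x =>
      (Q.hasFDerivAt).clm_apply (hasFDerivAt_const y x)
    have e := eq_of_hasFDerivAt_zero hU hconv (f := fun x => ψ x * β x y - 2 * c * Q x y)
      (fun x hx => ⟨_, ((dψ x hx).mul (dβ x hx y)).sub ((dQ x).const_mul (2 * c)),
        fun u => ?_⟩) hx hx₀
    · have := Q_x₁ y
      rw [map_sub, sub_apply]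
      have h4 : c * (ψ x * β x y - 2 * c * (Q x y - Q x₁ y)) = 0 := by
        linear_combination c * e + (1 / 4) * this
      rcases mul_eq_zero.1 h4 with h5 | h5
      · exact absurd h5 hc
      · linarith
    · simp only [add_apply, sub_apply, smul_apply, smul_eq_mul, eβ x hx,
        ContinuousLinearMap.comp_apply, ContinuousLinearMap.flip_apply, zero_apply, map_zero,
        ← Q_eq x hx]
      ring
  set M := ψ x₀ + 4 * c ^ 2 * Q (x₀ - x₁) (x₀ - x₁) with hM
  have ψ_eq : ∀ x ∈ U, ψ x + 4 * c ^ 2 * Q (x - x₁) (x - x₁) = M := by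
    intro x hx
    have ds : ∀ x, HasFDerivAt (fun x => x - x₁)
      (ContinuousLinearMap.id ℝ (EuclideanSpace ℝ (Fin n))) x := fun x =>
      (hasFDerivAt_id x).sub_const x₁
    have dQ : ∀ x, HasFDerivAt (fun x => Q (x - x₁) (x - x₁)) _ x := fun x =>
      ((Q.hasFDerivAt).comp x (ds x)).clm_apply (ds x)
    refine eq_of_hasFDerivAt_zero hU hconv
      (f := fun x => ψ x + 4 * c ^ 2 * Q (x - x₁) (x - x₁))
      (fun x hx => ⟨_, (dψ x hx).add ((dQ x).const_mul (4 * c ^ 2)), fun u => ?_⟩) hx hx₀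
    simp only [add_apply, smul_apply, smul_eq_mul, ContinuousLinearMap.comp_apply,
      ContinuousLinearMap.flip_apply, ContinuousLinearMap.id_apply, Function.comp_apply,
      Q_symm u]
    linear_combination (-4 * c) * grad x hx u
  have Mpos : 0 < M := by
    have : 0 ≤ Q (x₀ - x₁) (x₀ - x₁) := by
      by_cases h : x₀ - x₁ = 0
      · simp [h]
      · exact (Q_pos _ h).le
    have := ψpos x₀
    positivity
  -- Dividing `Q` by `M` makes `M` a common factor of `ψ` and `Q`, so it cancels from the formulas
  -- for `β` and `g`.
  obtain ⟨L, hL⟩ := exists_linearEquiv_inner_eq (finrank_euclideanSpace_fin (𝕜 := ℝ) (n := n))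
    (M⁻¹ • B) (fun v w => by simp [B, Q_symm v w])
    (fun v hv => mul_pos (inv_pos.2 Mpos) (Q_pos v hv))
  have hL' : ∀ v w, Q v w = M * inner ℝ (L v) (L w) := fun v w => by
    have : (M⁻¹ • B) v w = M⁻¹ * Q v w := rfl
    rw [hL, this]; field_simp
  let φ : EuclideanSpace ℝ (Fin n) ≃ᵃ[ℝ] EuclideanSpace ℝ (Fin n) :=
    (AffineEquiv.constVAdd ℝ _ (-x₁)).trans L.toAffineEquiv
  have hφ : ∀ x, φ x = L (x - x₁) := fun x => by
    simp [φ, neg_add_eq_sub]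
  have hφL : ∀ y, φ.linear y = L y := fun y => rfl
  have ψ_eq' : ∀ x ∈ U, ψ x = M * (1 - 4 * c ^ 2 * ‖φ x‖ ^ 2) := by
    intro x hx
    rw [hφ, ← real_inner_self_eq_norm_sq]
    have := ψ_eq x hx
    rw [hL'] at this
    linear_combination this
  have hball : ∀ x ∈ U, 0 < 1 - 4 * c ^ 2 * ‖φ x‖ ^ 2 := fun x hx =>
    (mul_pos_iff_of_pos_left Mpos).1 (ψ_eq' x hx ▸ ψpos x)
  have hβ : ∀ x ∈ U, ∀ y, β x y = modelB c (φ x, φ.linear y) := by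
    intro x hx y
    have e := grad x hx y
    have hb := hball x hx
    rw [ψ_eq' x hx, hL', ← hφ, ← hφL] at e
    rw [modelB_eq, eq_div_iff hb.ne']
    exact mul_left_cancel₀ Mpos.ne' (by linear_combination e)
  refine ⟨φ, fun x hx => sub_pos.1 (hball x hx), fun x hx y => ⟨?_, hβ x hx y⟩⟩
  rw [modelA_eq_sqrt (sub_pos.1 (hball x hx)), ← hβ x hx]
  congr 1
  have e := Q_eq x hx y y
  have hb := hball x hx
  rw [ψ_eq' x hx, hL', real_inner_self_eq_norm_sq, ← hφL] at e
  have e' := mul_left_cancel₀ Mpos.ne' ((mul_assoc _ _ _).symm.trans e)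
  rw [← e']
  field_simp
  ring

/-! ### Riemannian part in the normal form with parameter `μ` -/

theorem kleinMetric_sq {μ : ℝ} {x y : EuclideanSpace ℝ (Fin n)} (hx : 0 < 1 + μ * ‖x‖ ^ 2)
    (hy : 0 < kleinMetric μ (x, y)) :
    kleinMetric μ (x, y) ^ 2
      = ‖y‖ ^ 2 * (1 + μ * ‖x‖ ^ 2)⁻¹ - μ * (inner ℝ x y * (1 + μ * ‖x‖ ^ 2)⁻¹) ^ 2 := by
  rw [kleinMetric] at hy ⊢
  -- A positive value of the root excludes the default value `0` at a negative radicand.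
  have h1 := Real.sqrt_pos.1 ((div_pos_iff_of_pos_right hx).1 hy)
  rw [div_pow, Real.sq_sqrt h1.le]
  field_simp
  ring

/-- Put `ρ = 1 + μ |x|²` and `T = ⟨x, y⟩ / ρ`, so that `g(y, y) = |y|² / ρ - μ T²`. Along `y`, the
derivative of `T` is `g(y, y) - μ T²` and that of `g(y, y)` is `-4 μ T g(y, y)`. The equation for
`Dg` then gives `2 c β(y) = -μ T`, and the equation for `Dβ` gives `μ = -4 c²`. -/
theorem form_eq_of_kleinMetric {μ : ℝ} (hn : 2 ≤ n) (hne : U.Nonempty)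
    (hc : c ≠ 0) (hd : IsRandersData U g β) (hμ : ∀ x ∈ U, 0 < 1 + μ * ‖x‖ ^ 2)
    (hg : ∀ x ∈ U, ∀ y, kleinMetric μ (x, y) = Real.sqrt (g x y y))
    (h1 : ∀ x ∈ U, ∀ u y, fderiv ℝ β x u y = 2 * c * (g x u y + β x u * β x y))
    (h2 : ∀ x ∈ U, ∀ u y, fderiv ℝ g x u y y = 4 * c * (g x y y * β x u + g x u y * β x y)) :
    μ = -4 * c ^ 2 ∧ ∀ x ∈ U, ∀ y, β x y = modelB c (x, y) := by
  have hU := hd.isOpen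
  have dρ : ∀ x : EuclideanSpace ℝ (Fin n), ∃ f : EuclideanSpace ℝ (Fin n) →L[ℝ] ℝ,
      HasFDerivAt (fun x => 1 + μ * ‖x‖ ^ 2) f x ∧ ∀ u, f u = 2 * μ * inner ℝ x u := by
    intro x
    refine ⟨_, ((hasFDerivAt_id x).norm_sq.const_mul μ).const_add 1, fun u => ?_⟩
    simp
    ring
  have dT : ∀ x ∈ U, ∀ y, ∃ f : EuclideanSpace ℝ (Fin n) →L[ℝ] ℝ,
      HasFDerivAt (fun x => inner ℝ x y * (1 + μ * ‖x‖ ^ 2)⁻¹) f x ∧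
        f y = ‖y‖ ^ 2 * (1 + μ * ‖x‖ ^ 2)⁻¹
          - 2 * μ * (inner ℝ x y * (1 + μ * ‖x‖ ^ 2)⁻¹) ^ 2 := by
    intro x hx y
    obtain ⟨f, hf, hf'⟩ := dρ x
    refine ⟨_, ((hasFDerivAt_id x).inner ℝ (hasFDerivAt_const y x)).mul
      ((hasDerivAt_inv (hμ x hx).ne').comp_hasFDerivAt x hf), ?_⟩
    have := (hμ x hx).ne'
    simp [hf']
    field_simp
    ring
  have gdiag : ∀ x ∈ U, ∀ y, y ≠ 0 → g x y y
      = ‖y‖ ^ 2 * (1 + μ * ‖x‖ ^ 2)⁻¹ - μ * (inner ℝ x y * (1 + μ * ‖x‖ ^ 2)⁻¹) ^ 2 := by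
    intro x hx y hy
    have hp := hd.pos x hx y hy
    rw [← kleinMetric_sq (hμ x hx) (by rw [hg x hx]; exact Real.sqrt_pos.2 hp), hg x hx,
      Real.sq_sqrt hp.le]
  have βeq : ∀ x ∈ U, ∀ y, y ≠ 0 →
      2 * c * β x y = -μ * (inner ℝ x y * (1 + μ * ‖x‖ ^ 2)⁻¹) := by
    intro x hx y hy
    obtain ⟨f, hf, hf'⟩ := dρ x
    obtain ⟨k, hk, hk'⟩ := dT x hx y
    have e1 : (fun x => g x y y) =ᶠ[nhds x] fun x => ‖y‖ ^ 2 * (1 + μ * ‖x‖ ^ 2)⁻¹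
        - μ * ((inner ℝ x y * (1 + μ * ‖x‖ ^ 2)⁻¹) * (inner ℝ x y * (1 + μ * ‖x‖ ^ 2)⁻¹)) := by
      filter_upwards [hU.mem_nhds hx] with p hp
      rw [gdiag p hp y hy, sq (inner ℝ p y * _)]
    have e2 : HasFDerivAt (fun x => ‖y‖ ^ 2 * (1 + μ * ‖x‖ ^ 2)⁻¹
        - μ * ((inner ℝ x y * (1 + μ * ‖x‖ ^ 2)⁻¹) * (inner ℝ x y * (1 + μ * ‖x‖ ^ 2)⁻¹))) _ x :=
      (((hasDerivAt_inv (hμ x hx).ne').comp_hasFDerivAt x hf).const_mul (‖y‖ ^ 2)).sub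
        ((hk.mul hk).const_mul μ)
    -- On the diagonal `u = y` the right side is `8 c g(y, y) β(y)`, so `β(y)` can be solved for.
    have e3 := h2 x hx y y
    rw [← fderiv_clm_apply_const₂ (hd.hasFDerivAt_metric hx).differentiableAt, e1.fderiv_eq,
      e2.fderiv] at e3
    simp only [add_apply, sub_apply, smul_apply, smul_eq_mul, hf', hk'] at e3
    have hp := hd.pos x hx y hy
    refine mul_left_cancel₀ hp.ne' ?_
    have e4 := gdiag x hx y hy
    have e5 : -((1 + μ * ‖x‖ ^ 2) ^ 2)⁻¹ * (2 * μ * inner ℝ x y)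
      = - 2 * μ * (inner ℝ x y * (1 + μ * ‖x‖ ^ 2)⁻¹) * (1 + μ * ‖x‖ ^ 2)⁻¹ := by
      have := (hμ x hx).ne'
      field_simp
    rw [e5] at e3
    set T := inner ℝ x y * (1 + μ * ‖x‖ ^ 2)⁻¹
    linear_combination (-1 / 4) * e3 + μ * T * e4
  have hμc : μ = -4 * c ^ 2 := by
    obtain ⟨x, hx⟩ := hne
    obtain ⟨y, v, hyv⟩ := exists_linearIndependent_pair hn
    have hy : y ≠ 0 := by simpa using hyv.ne_zero 0
    obtain ⟨k, hk, hk'⟩ := dT x hx y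
    have e1 : (fun x => β x y) =ᶠ[nhds x]
        fun x => -μ / (2 * c) * (inner ℝ x y * (1 + μ * ‖x‖ ^ 2)⁻¹) := by
      filter_upwards [hU.mem_nhds hx] with p hp
      have := βeq p hp y hy
      field_simp at this ⊢
      linear_combination this
    have e2 := h1 x hx y y
    rw [← fderiv_clm_apply_const (hd.hasFDerivAt_form hx).differentiableAt, e1.fderiv_eq,
      (hk.const_mul _).fderiv] at e2
    simp only [smul_apply, smul_eq_mul, hk'] at e2
    have hp := hd.pos x hx y hy
    have e3 := gdiag x hx y hy
    have e4 := βeq x hx y hy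
    refine mul_left_cancel₀ hp.ne' ?_
    -- The equation for `Dβ` on the diagonal, multiplied by `2 c`. The terms `μ² T²` cancel and
    -- leave `-μ g(y, y) = 4 c² g(y, y)`.
    have e5 : -μ * (‖y‖ ^ 2 * (1 + μ * ‖x‖ ^ 2)⁻¹
        - 2 * μ * (inner ℝ x y * (1 + μ * ‖x‖ ^ 2)⁻¹) ^ 2)
        = 4 * c ^ 2 * g x y y + (2 * c * β x y) ^ 2 := by
      have : -μ / (2 * c) * (2 * c) = -μ := by field_simp
      linear_combination (2 * c) * e2 - (‖y‖ ^ 2 * (1 + μ * ‖x‖ ^ 2)⁻¹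
        - 2 * μ * (inner ℝ x y * (1 + μ * ‖x‖ ^ 2)⁻¹) ^ 2) * this
    rw [e4] at e5
    linear_combination (-1) * e5 + μ * e3
  refine ⟨hμc, fun x hx y => ?_⟩
  by_cases hy : y = 0
  · simp [hy, modelB]
  · have e := βeq x hx y hy
    have hp := hμ x hx
    rw [hμc] at e hp
    have hp' : 0 < 1 - 4 * c ^ 2 * ‖x‖ ^ 2 := by linarith
    rw [show 1 + -4 * c ^ 2 * ‖x‖ ^ 2 = 1 - 4 * c ^ 2 * ‖x‖ ^ 2 by ring] at e
    rw [modelB_eq]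
    refine mul_left_cancel₀ (mul_ne_zero two_ne_zero hc) (e.trans ?_)
    field_simp
    ring

end Classification

end FinslerGeom

end

theorem lemma4p4 (n : ℕ) (hn : 2 ≤ n) :
    -- the displayed metrics have the stated properties
    (∀ c : ℝ, c ≠ 0 →
      FinslerGeom.IsProportionalRanders (FinslerGeom.modelBall n c)
        (FinslerGeom.modelA c) (FinslerGeom.modelB c) c (-c ^ 2)) ∧
    -- they are the only ones whose Riemannian part is in the normal form with parameter `μ`
    (∀ (U : Set (EuclideanSpace ℝ (Fin n))) (a b : EuclideanSpace ℝ (Fin n) ×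
        EuclideanSpace ℝ (Fin n) → ℝ) (c κ μ : ℝ),
      IsOpen U → Convex ℝ U → U.Nonempty →
      (∀ x ∈ U, 0 < 1 + μ * ‖x‖ ^ 2) →
      (∀ x ∈ U, ∀ y : EuclideanSpace ℝ (Fin n), a (x, y) = FinslerGeom.kleinMetric μ (x, y)) →
      (FinslerGeom.IsProportionalRanders U a b c κ ↔
        c ≠ 0 ∧ κ = -c ^ 2 ∧ μ = -4 * c ^ 2 ∧ U ⊆ FinslerGeom.modelBall n c ∧
        ∀ x ∈ U, ∀ y : EuclideanSpace ℝ (Fin n),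
          a (x, y) = FinslerGeom.modelA c (x, y) ∧ b (x, y) = FinslerGeom.modelB c (x, y))) ∧
    -- and, without normalization, the only ones up to an affine change of coordinates
    (∀ (U : Set (EuclideanSpace ℝ (Fin n))) (a b : EuclideanSpace ℝ (Fin n) ×
        EuclideanSpace ℝ (Fin n) → ℝ) (c κ : ℝ),
      IsOpen U → Convex ℝ U → U.Nonempty →
      (FinslerGeom.IsProportionalRanders U a b c κ ↔
        c ≠ 0 ∧ κ = -c ^ 2 ∧
        ∃ φ : EuclideanSpace ℝ (Fin n) ≃ᵃ[ℝ] EuclideanSpace ℝ (Fin n),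
          (∀ x ∈ U, φ x ∈ FinslerGeom.modelBall n c) ∧
          ∀ x ∈ U, ∀ y : EuclideanSpace ℝ (Fin n),
            a (x, y) = FinslerGeom.modelA c (φ x, φ.linear y) ∧
            b (x, y) = FinslerGeom.modelB c (φ x, φ.linear y))) := by
  open FinslerGeom in
  refine ⟨fun c hc => isProportionalRanders_of_subset_modelBall hn (isOpen_modelBall c)
      ⟨0, by simp [modelBall]⟩ hc subset_rfl fun x _ y => ⟨rfl, rfl⟩, ?_, ?_⟩
  · intro U a b c κ μ hU hconv hne hμ ha
    constructor
    · intro h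
      obtain ⟨hc, hκ, g, β, hd, hag, hbβ, h1, h2⟩ :=
        (isProportionalRanders_iff hU hne (exists_linearIndependent_pair hn) a b c κ).1 h
      obtain ⟨rfl, hβ⟩ := form_eq_of_kleinMetric hn hne hc hd hμ
        (fun x hx y => (ha x hx y).symm.trans (hag x hx y)) h1 h2
      refine ⟨hc, hκ, rfl, fun x hx => ?_, fun x hx y => ⟨?_, (hbβ x hx y).trans (hβ x hx y)⟩⟩
      · have := hμ x hx
        rw [modelBall, Set.mem_ofPred_eq]
        linarith
      · rw [ha x hx y, kleinMetric, modelA]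
        congr 1
        · congr 1; ring
        · ring
    · rintro ⟨hc, rfl, -, hball, hab⟩
      exact isProportionalRanders_of_subset_modelBall hn hU hne hc hball hab
  · intro U a b c κ hU hconv hne
    constructor
    · intro h
      obtain ⟨hc, hκ, g, β, hd, hag, hbβ, h1, h2⟩ :=
        (isProportionalRanders_iff hU hne (exists_linearIndependent_pair hn) a b c κ).1 h
      obtain ⟨φ, hφ, hab⟩ := exists_affineEquiv_of_system hconv hne hc hd h1 h2
      exact ⟨hc, hκ, φ, hφ, fun x hx y =>
        ⟨(hag x hx y).trans (hab x hx y).1, (hbβ x hx y).trans (hab x hx y).2⟩⟩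
    · rintro ⟨hc, rfl, φ, hφ, hab⟩
      exact isProportionalRanders_of_model hn hU hne hc φ hφ hab
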